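/- Let $\mathcal H$ be a finite-dimensional complex Hilbert space and $\mathcal B(\mathcal H)$ the algebra of linear operators on it; let $\mathcal D(\mathcal H)$ be the set of states (positive semidefinite operators of trace $1$) and $\mathcal D_+(\mathcal H)$ the set of states of full rank. Let $(\Lambda_t)_{t\ge0}$ be a quantum Markov semigroup on $\mathcal B(\mathcal H)$, that is, a strongly continuous semigroup of completely positive unital linear maps with $\Lambda_0=\mathrm{id}$, and suppose that it is primitive: it has exactly one invariant state $\sigma$ (a state with $\operatorname{Tr}(\sigma\Lambda_t(f))=\operatorname{Tr}(\sigma f)$ for all $t\ge 0$ and all $f$), and $\sigma\in\mathcal D_+(\mathcal H)$. Suppose that its generator has the detailed-balance form $$\mathcal L(f)=\sum_{j\in\mathcal J}c_j\Big(e^{-\omega_j/2}L_j^*[f,L_j]+e^{\omega_j/2}[L_j,f]L_j^*\Big),$$ where $\mathcal J$ is a finite set, $c_j>0$, $\omega_j\in\mathbb R$, $\{L_j\}=\{L_j^*\}$, $\sigma L_j\sigma^{-1}=e^{-\omega_j}L_j$, $\frac1{\dim\mathcal H}\operatorname{Tr}(L_j^*L_k)=\delta_{jk}$, $\operatorname{Tr}L_j=0$,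 and $c_j=c_k$ whenever $L_j^*=L_k$. For $\rho\in\mathcal D_+(\mathcal H)$ put $D(\rho\|\sigma)=\operatorname{Tr}(\rho(\log\rho-\log\sigma))$, $\Gamma_\sigma(f)=\sigma^{1/2}f\sigma^{1/2}$, $\mathcal E_1(f,f)=-\frac12\operatorname{Tr}\big(\Gamma_\sigma(\mathcal L(f))(\log\Gamma_\sigma(f)-\log\sigma)\big)$ and $\operatorname{EP}_\sigma(\rho)=2\mathcal E_1(\Gamma_\sigma^{-1}(\rho),\Gamma_\sigma^{-1}(\rho))$. Put $\partial_jU=[L_j,U]$, $\operatorname{div}(\mathbf A)=\sum_jc_j[A_j,L_j^*]$, and $[\rho]_{\omega}(A)=\big(f_{\omega}(\Delta_\rho)(A)\big)\rho$, where $\Delta_\rho(A)=\rho A\rho^{-1}$ and $f_\omega(t)=e^{\omega/2}\frac{t-e^{-\omega}}{\log t+\omega}$ for $t>0$ (with $f_\omega(e^{-\omega})=e^{-\omega/2}$). The Wasserstein distance of $\rho,\tau\in\mathcal D_+(\mathcal H)$ is $$W_{2,\mathcal L}(\rho,\tau)=\inf\Big(\int_0^1\sum_{j\in\mathcal J} c_j\operatorname{Tr}\big((\partial_jU(s))^*\,[\gamma(s)]_{\omega_j}(\partial_jU(s))\big)\,ds\Big)^{1/2},$$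 the infimum being over smooth paths $\gamma:[0,1]\to\mathcal D_+(\mathcal H)$ with $\gamma(0)=\rho$, $\gamma(1)=\tau$, and traceless self-adjoint $U(s)$ with $\dot\gamma(s)=-\operatorname{div}\big(([\gamma(s)]_{\omega_j}\partial_jU(s))_{j\in\mathcal J}\big)$ for all $s\in[0,1]$. Let $\alpha_1>0$ and suppose that the modified logarithmic Sobolev inequality MLSI$(\alpha_1)$ holds: $$2\alpha_1D(\rho\|\sigma)\le\operatorname{EP}_\sigma(\rho)\qquad\text{for all }\rho\in\mathcal D_+(\mathcal H).$$ Then the transportation cost inequality TC$_2(c_2)$ holds with $c_2=1/\alpha_1$: $$W_{2,\mathcal L}(\rho,\sigma)\le\sqrt{2c_2D(\rho\|\sigma)}\qquad\text{for all }\rho\in\mathcal D_+(\mathcal H).$$ -/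

import Mathlib

open scoped CStarAlgebra

noncomputable section

namespace QMS

/-- The algebra `B(H)` of linear operators on `H` (for finite-dimensional `H` every linear operator
is bounded); `star` is the adjoint. -/
abbrev Op (H : Type*) [NormedAddCommGroup H] [InnerProductSpace ℂ H] : Type _ := H →L[ℂ] H

theorem finite_realSpectrum {H : Type*} [NormedAddCommGroup H] [InnerProductSpace ℂ H]
    [FiniteDimensional ℂ H] (ρ : Op H) : (spectrum ℝ ρ).Finite := by
  have h : (spectrum ℂ ρ).Finite := by
    have e := AlgEquiv.spectrum_eq (Module.End.toContinuousLinearMap (𝕜 := ℂ) H).symm ρ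
    rw [← e]
    exact Module.End.finite_spectrum _
  rw [← spectrum.preimage_algebraMap ℂ]
  exact h.preimage (FaithfulSMul.algebraMap_injective ℝ ℂ).injOn

variable {H : Type*} [NormedAddCommGroup H] [InnerProductSpace ℂ H] [CompleteSpace H]
  [FiniteDimensional ℂ H]

/-- The (unnormalised) trace on `B(H)`. -/
def tr (A : Op H) : ℂ := LinearMap.trace ℂ H (A : H →ₗ[ℂ] H)

/-- The commutator `[A, B] = A B - B A`. -/
def comm (A B : Op H) : Op H := A * B - B * A

/-- The Hilbert--Schmidt inner product `Tr (A^* B)`. -/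
def hsInner (A B : Op H) : ℂ := tr (star A * B)

/-- `ρ` is a state (density operator). -/
def IsState (ρ : Op H) : Prop := 0 ≤ ρ ∧ tr ρ = 1

/-- `ρ` is a full-rank state: positive and invertible, with unit trace. -/
def IsFullRankState (ρ : Op H) : Prop := IsStrictlyPositive ρ ∧ tr ρ = 1

/-- The operator logarithm, through the spectral decomposition. -/
def opLog (ρ : Op H) : Op H := cfc Real.log ρ

/-- Real powers of a positive invertible operator, through the spectral decomposition. -/
def opPow (ρ : Op H) (s : ℝ) : Op H := cfc (fun x : ℝ => x ^ s) ρ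

/-- Umegaki's relative entropy `D(ρ‖σ) = Tr (ρ (log ρ - log σ))` of full-rank states. -/
def relEntropy (ρ σ : Op H) : ℝ := (tr (ρ * (opLog ρ - opLog σ))).re

/-! Quantum Markov semigroups -/

/-- `Λ`, restricted to times `t ≥ 0`, is a quantum Markov semigroup (in the Heisenberg picture). -/
structure IsQuantumMarkovSemigroup (Λ : ℝ → Op H →ₗ[ℂ] Op H) : Prop where
  completelyPositive : ∀ t, 0 ≤ t → ∃ Φ : Op H →CP Op H, Φ.toLinearMap = Λ t
  unital : ∀ t, 0 ≤ t → Λ t 1 = 1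
  zero : Λ 0 = LinearMap.id
  add : ∀ s t, 0 ≤ s → 0 ≤ t → Λ (s + t) = Λ s ∘ₗ Λ t
  continuous_zero : ∀ f, Filter.Tendsto (fun t => Λ t f) (nhdsWithin 0 (Set.Ici 0)) (nhds f)

/-- `𝓛` is the generator of `Λ`: `d/dt Λ_t = Λ_t ∘ 𝓛 = 𝓛 ∘ Λ_t` for all `t ≥ 0`. -/
def IsGenerator (Λ : ℝ → Op H →ₗ[ℂ] Op H) (𝓛 : Op H → Op H) : Prop :=
  ∀ t, 0 ≤ t → ∀ f : Op H,
    HasDerivWithinAt (fun s => Λ s f) (Λ t (𝓛 f)) (Set.Ici 0) t ∧ Λ t (𝓛 f) = 𝓛 (Λ t f)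

/-- `ρ` is invariant: `Tr (ρ Λ_t(f)) = Tr (ρ f)` for all `f` and all `t ≥ 0`. -/
def IsInvariant (Λ : ℝ → Op H →ₗ[ℂ] Op H) (ρ : Op H) : Prop :=
  ∀ t, 0 ≤ t → ∀ f : Op H, tr (ρ * Λ t f) = tr (ρ * f)

/-- `Λ` is primitive with invariant state `σ`: `σ` has full rank and is the only invariant state. -/
structure IsPrimitive (Λ : ℝ → Op H →ₗ[ℂ] Op H) (σ : Op H) : Prop where
  fullRank : IsFullRankState σ
  invariant : IsInvariant Λ σ
  unique : ∀ ρ : Op H, IsState ρ → IsInvariant Λ ρ → ρ = σ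

/-! The detailed-balance form of the generator -/

/-- The data `({c_j}, {ω_j}, {L_j})` of a detailed-balance representation. -/
structure Rep (H : Type*) [NormedAddCommGroup H] [InnerProductSpace ℂ H] (J : Type*) where
  c : J → ℝ
  ω : J → ℝ
  L : J → Op H

namespace Rep

variable {J : Type*} [Fintype J] (R : Rep H J)

/-- The conditions on the data of a detailed-balance representation with respect to `σ`. -/
structure IsDetailedBalance (σ : Op H) : Prop where
  c_pos : ∀ j, 0 < R.c j
  star_closed : Set.range R.L = Set.range (fun j => star (R.L j))
  /-- `Δ_σ(L_j) = σ L_j σ⁻¹ = exp(-ω_j) L_j`. -/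
  modular : ∀ j, σ * R.L j * Ring.inverse σ = Real.exp (-R.ω j) • R.L j
  orthonormal_self : ∀ j, hsInner (R.L j) (R.L j) / (Module.finrank ℂ H : ℂ) = 1
  orthogonal : ∀ j k, j ≠ k → hsInner (R.L j) (R.L k) / (Module.finrank ℂ H : ℂ) = 0
  traceless : ∀ j, tr (R.L j) = 0
  c_symm : ∀ j k, star (R.L j) = R.L k → R.c j = R.c k

/-- `𝓛(f) = ∑_j c_j (exp(-ω_j/2) L_j^* [f, L_j] + exp(ω_j/2) [L_j, f] L_j^*)`. -/
def generator (f : Op H) : Op H :=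
  ∑ j, R.c j • (Real.exp (-R.ω j / 2) • (star (R.L j) * comm f (R.L j)) +
    Real.exp (R.ω j / 2) • (comm (R.L j) f * star (R.L j)))

/-- The gradient `∇U = (∂_j U)_j`, where `∂_j U = [L_j, U]`. -/
def grad (U : Op H) (j : J) : Op H := comm (R.L j) U

/-- The divergence `div A = ∑_j c_j [A_j, L_j^*]`. -/
def div (A : J → Op H) : Op H := ∑ j, R.c j • comm (A j) (star (R.L j))

end Rep

/-! Functional calculus of the modular operator, and the operators `[ρ]_ω` -/

/-- The spectral projection `P_x(ρ)` of a self-adjoint operator: the orthogonal projection onto the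
eigenspace of `x`. -/
def spectralProj (ρ : Op H) (x : ℝ) : Op H :=
  cfc (fun y : ℝ => if y = x then (1 : ℝ) else 0) ρ

/-- `φ(Δ_ρ)` for the modular operator `Δ_ρ(A) = ρ A ρ⁻¹`, through its spectral decomposition:
`φ(Δ_ρ)(A) = ∑_{x, y ∈ sp(ρ)} φ(x / y) P_x(ρ) A P_y(ρ)`. -/
def modularCalc (φ : ℝ → ℝ) (ρ A : Op H) : Op H :=
  ∑ x ∈ (finite_realSpectrum ρ).toFinset, ∑ y ∈ (finite_realSpectrum ρ).toFinset,
    φ (x / y) • (spectralProj ρ x * A * spectralProj ρ y)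

/-- `f_ω(t) = exp(ω/2) (t - exp(-ω)) / (log t + ω)` for `t > 0`, extended by continuity to the
removable singularity `t = exp(-ω)`. -/
def fOmega (ω t : ℝ) : ℝ :=
  if t = Real.exp (-ω) then Real.exp (-ω / 2)
  else Real.exp (ω / 2) * ((t - Real.exp (-ω)) / (Real.log t + ω))

/-- `[ρ]_ω = R_ρ ∘ f_ω(Δ_ρ)`, where `R_ρ` is right multiplication by `ρ`. -/
def bracket (ρ : Op H) (ω : ℝ) (A : Op H) : Op H := modularCalc (fOmega ω) ρ A * ρ

namespace Rep

variable {J : Type*} [Fintype J] (R : Rep H J)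

/-! The Wasserstein distance of order two -/

/-- The squared norm `∑_j c_j ⟨V_j, [ρ]_{ω_j} V_j⟩_HS` of a vector field. -/
def normSq (ρ : Op H) (V : J → Op H) : ℝ :=
  (∑ j, (R.c j : ℂ) * hsInner (V j) (bracket ρ (R.ω j) (V j))).re

/-- `γ` is a smooth path `[0,1] → D_+(H)` from `ρ` to `σ` and `U` is a field of traceless
self-adjoint potentials such that the continuity equation `γ' = - div ([γ]_ω ∇U)` holds. -/
structure IsAdmissible (ρ σ : Op H) (γ U : ℝ → Op H) : Prop where
  smooth : ContDiffOn ℝ ((⊤ : ℕ∞) : WithTop ℕ∞) γ (Set.Icc 0 1)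
  fullRank : ∀ s ∈ Set.Icc (0 : ℝ) 1, IsFullRankState (γ s)
  source : γ 0 = ρ
  target : γ 1 = σ
  selfAdjoint : ∀ s ∈ Set.Icc (0 : ℝ) 1, IsSelfAdjoint (U s)
  traceless : ∀ s ∈ Set.Icc (0 : ℝ) 1, tr (U s) = 0
  continuity : ∀ s ∈ Set.Icc (0 : ℝ) 1,
    derivWithin γ (Set.Icc 0 1) s = - R.div (fun j => bracket (γ s) (R.ω j) (R.grad (U s) j))

/-- The Wasserstein distance `W_{2,𝓛}(ρ, σ)`, the infimum over admissible paths of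
`(∫₀¹ ‖∇U(s)‖²_{𝓛,γ(s)} ds)^{1/2}`, with value `∞` if there is no admissible path. -/
def W2 (ρ σ : Op H) : ENNReal :=
  ⨅ (γ : ℝ → Op H) (U : ℝ → Op H) (_ : R.IsAdmissible ρ σ γ U),
    (∫⁻ s in Set.Icc (0 : ℝ) 1, ENNReal.ofReal (R.normSq (γ s) (R.grad (U s)))) ^ (1 / 2 : ℝ)

/-- The transportation cost inequality `TC₂(c₂)`: `W_{2,𝓛}(ρ, σ) ≤ √(2 c₂ D(ρ‖σ))`. -/
def TC2 (σ : Op H) (c₂ : ℝ) : Prop :=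
  ∀ ρ : Op H, IsFullRankState ρ → R.W2 ρ σ ≤ ENNReal.ofReal (√(2 * c₂ * relEntropy ρ σ))

end Rep

/-! The modified logarithmic Sobolev inequality -/

/-- `Γ_σ(f) = σ^{1/2} f σ^{1/2}`. -/
def Gam (σ f : Op H) : Op H := opPow σ (1 / 2) * f * opPow σ (1 / 2)

/-- `Γ_σ⁻¹(f) = σ^{-1/2} f σ^{-1/2}`. -/
def GamInv (σ f : Op H) : Op H := opPow σ (-1 / 2) * f * opPow σ (-1 / 2)

/-- The `1`-Dirichlet form
`E₁(f, f) = - 1/2 Tr (Γ_σ(𝓛 f) (log Γ_σ(f) - log σ))`, for positive definite `f`. -/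
def dirichletOne (𝓛 : Op H → Op H) (σ f : Op H) : ℝ :=
  -(1 / 2) * (tr (Gam σ (𝓛 f) * (opLog (Gam σ f) - opLog σ))).re

/-- The entropy production, or quantum Fisher information,
`EP_σ(ρ) = I_σ(ρ) = 2 E₁(Γ_σ⁻¹ ρ, Γ_σ⁻¹ ρ)`. -/
def entropyProduction (𝓛 : Op H → Op H) (σ ρ : Op H) : ℝ :=
  2 * dirichletOne 𝓛 σ (GamInv σ ρ)

/-- The modified logarithmic Sobolev inequality `MLSI(α₁)`: `2 α₁ D(ρ‖σ) ≤ EP_σ(ρ)` for all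
full-rank states `ρ`. -/
def MLSI (𝓛 : Op H → Op H) (σ : Op H) (α₁ : ℝ) : Prop :=
  ∀ ρ : Op H, IsFullRankState ρ → 2 * α₁ * relEntropy ρ σ ≤ entropyProduction 𝓛 σ ρ

end QMS

end

/-! The Schrödinger flow `ρ_t = R.flow ρ t` is the gradient flow of `D(·‖σ)` for the metric defining
the transport distance. The noncommutative chain rule `bracket_comm_opLog_sub` turns `div ([ρ]_ω
∇(log ρ - log σ))` into the Schrödinger generator (`div_bracket_grad`). Hence the flow solves the
continuity equation with potential `-(log ρ_t - log σ)`, up to a scalar, and its squared speed is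
the entropy production, which is also `-d/dt D(ρ_t‖σ)`. MLSI then gives `D(ρ_t‖σ) ≤ e^{-2αt}
D(ρ‖σ)`, and a Pinsker-type bound gives exponential convergence to `σ` in norm.

An admissible path must reach `σ` at parameter `1` and be smooth there, so the infinite time axis is
compressed. With remaining parameter `u = 1 - s`, time is `clock α ε u`. Its term `-log u / α` makes
`e^{-αt}` linear in `u`, the profile of constant speed when the entropy decays exactly at rate `2α`.
Its term `ε/(αu)` adds a factor `e^{-ε/u}`, which beats every power of `1/u` and makes the path flat
at `s = 1` (`contDiff_of_flat`).

Write `r` for the rate, `e` for the entropy on the path, `D` for its initial value and `Q =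
e^{-2αt}`. The action is `∫ r² EP`, and `e' = -r EP`. Instead of integrating `-r e'` by parts,
`lintegral_normSq_flowPath_le` differentiates `W = r (D Q - e)`, which vanishes at both ends. As `r`
increases in `s` and `e ≤ D Q`, one gets `r² EP ≤ W' + 2α D r² Q`, and `r² Q ≤ (e^ε/α)²`. The action
is at most `2 D e^{2ε}/α`; letting `ε → 0` gives the claim. -/

set_option linter.unusedSectionVars false

noncomputable section

namespace QMS

variable {H : Type*} [NormedAddCommGroup H] [InnerProductSpace ℂ H] [CompleteSpace H]
  [FiniteDimensional ℂ H]

/-! ### The trace -/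

section Trace

open scoped ComplexOrder InnerProductSpace

/-- The trace as a continuous linear form. -/
def trCLM (H : Type*) [NormedAddCommGroup H] [InnerProductSpace ℂ H] [FiniteDimensional ℂ H] :
    Op H →L[ℂ] ℂ :=
  LinearMap.toContinuousLinearMap
    (LinearMap.trace ℂ H ∘ₗ (ContinuousLinearMap.coeLM ℂ : (H →L[ℂ] H) →ₗ[ℂ] (H →ₗ[ℂ] H)))

theorem trCLM_apply (A : Op H) : trCLM H A = tr A := rfl

theorem tr_add (A B : Op H) : tr (A + B) = tr A + tr B := map_add (trCLM H) A B

theorem tr_sub (A B : Op H) : tr (A - B) = tr A - tr B := map_sub (trCLM H) A B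

theorem tr_neg (A : Op H) : tr (-A) = -tr A := map_neg (trCLM H) A

theorem tr_real_smul (r : ℝ) (A : Op H) : tr (r • A) = r * tr A :=
  (map_smul (trCLM H) (r : ℂ) A)

theorem tr_sum {ι : Type*} (s : Finset ι) (A : ι → Op H) :
    tr (∑ i ∈ s, A i) = ∑ i ∈ s, tr (A i) := map_sum (trCLM H) A s

theorem tr_mul_comm (A B : Op H) : tr (A * B) = tr (B * A) :=
  LinearMap.trace_mul_comm ℂ (A : H →ₗ[ℂ] H) (B : H →ₗ[ℂ] H)

theorem tr_one : tr (1 : Op H) = Module.finrank ℂ H := LinearMap.trace_one ℂ H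

theorem tr_eq_sum_inner (A : Op H) :
    tr A = ∑ i, ⟪stdOrthonormalBasis ℂ H i, A (stdOrthonormalBasis ℂ H i)⟫_ℂ :=
  LinearMap.trace_eq_sum_inner (A : H →ₗ[ℂ] H) (stdOrthonormalBasis ℂ H)

theorem tr_star (A : Op H) : tr (star A) = star (tr A) := by
  rw [tr_eq_sum_inner, tr_eq_sum_inner, star_sum]
  refine Finset.sum_congr rfl fun i _ => ?_
  rw [ContinuousLinearMap.star_eq_adjoint, ContinuousLinearMap.adjoint_inner_right]
  exact (inner_conj_symm _ _).symm

theorem tr_nonneg {A : Op H} (hA : 0 ≤ A) : 0 ≤ tr A := by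
  rw [tr_eq_sum_inner]
  exact Finset.sum_nonneg fun i _ =>
    ((ContinuousLinearMap.nonneg_iff_isPositive A).1 hA).inner_nonneg_right _

theorem tr_mul_nonneg {A B : Op H} (hA : 0 ≤ A) (hB : 0 ≤ B) : 0 ≤ tr (A * B) := by
  obtain ⟨C, rfl⟩ := CStarAlgebra.nonneg_iff_eq_star_mul_self.1 hA
  rw [mul_assoc, tr_mul_comm, mul_assoc, ← mul_assoc]
  simpa using tr_nonneg (star_right_conjugate_nonneg hB C)

/-- An operator whose trace against every positive operator is nonnegative is positive. -/
theorem nonneg_of_tr_mul_nonneg {A : Op H} (h : ∀ B : Op H, 0 ≤ B → 0 ≤ tr (A * B)) : 0 ≤ A := by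
  have key : ∀ v : H, 0 ≤ ⟪v, A v⟫_ℂ := by
    intro v
    have h1 := h (InnerProductSpace.rankOne ℂ v v)
      ((ContinuousLinearMap.nonneg_iff_isPositive _).2
        (InnerProductSpace.isPositive_rankOne_self v))
    have h2 : A * InnerProductSpace.rankOne ℂ v v = InnerProductSpace.rankOne ℂ (A v) v := by
      ext w
      simp
    rw [h2] at h1
    rwa [tr, InnerProductSpace.trace_rankOne] at h1
  rw [ContinuousLinearMap.nonneg_iff_isPositive, ContinuousLinearMap.isPositive_iff_complex]
  intro v
  have h1 : 0 ≤ ⟪A v, v⟫_ℂ := by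
    rw [← inner_conj_symm]
    exact star_nonneg_iff.2 (key v)
  have h2 := Complex.nonneg_iff.1 h1
  exact ⟨Complex.ext (by simp) (by simpa using h2.2), h2.1⟩

/-- The trace of a self-adjoint operator is real. -/
theorem tr_im_eq_zero {A : Op H} (hA : IsSelfAdjoint A) : (tr A).im = 0 := by
  have h := tr_star A
  rw [hA.star_eq] at h
  exact Complex.conj_eq_iff_im.1 h.symm

end Trace

/-! ### Spectral decomposition -/

section Spectral

/-- The spectrum of an operator as a finite set. -/
abbrev specSet (ρ : Op H) : Finset ℝ := (finite_realSpectrum ρ).toFinset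

theorem continuousOn_realSpectrum (ρ : Op H) (g : ℝ → ℝ) : ContinuousOn g (spectrum ℝ ρ) :=
  (finite_realSpectrum ρ).continuousOn g

variable {ρ σ : Op H}

theorem cfc_eq_sum_spectralProj (ρ : Op H) (g : ℝ → ℝ) :
    cfc g ρ = ∑ x ∈ specSet ρ, g x • spectralProj ρ x := by
  have h : ∀ x, g x • spectralProj ρ x = cfc (fun y : ℝ => g x • if y = x then (1 : ℝ) else 0) ρ :=
    fun x => (cfc_smul (g x) _ ρ (continuousOn_realSpectrum ρ _)).symm
  simp_rw [h]
  rw [← cfc_sum _ _ _ (fun x _ => continuousOn_realSpectrum ρ _)]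
  refine cfc_congr fun y hy => ?_
  have hy' : y ∈ specSet ρ := by simpa using hy
  simp [Finset.sum_apply, hy]

theorem cfc_mul_spectralProj (g : ℝ → ℝ) (x : ℝ) :
    cfc g ρ * spectralProj ρ x = g x • spectralProj ρ x := by
  rw [spectralProj, ← cfc_mul _ _ ρ (continuousOn_realSpectrum ρ _) (continuousOn_realSpectrum ρ _),
    ← cfc_smul _ _ ρ (continuousOn_realSpectrum ρ _)]
  refine cfc_congr fun y _ => ?_
  by_cases hyx : y = x <;> simp [hyx]

theorem spectralProj_mul_cfc (g : ℝ → ℝ) (x : ℝ) :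
    spectralProj ρ x * cfc g ρ = g x • spectralProj ρ x := by
  rw [← cfc_mul_spectralProj, spectralProj]
  exact cfc_commute_cfc _ _ _

theorem spectralProj_mul_spectralProj (x y : ℝ) :
    spectralProj ρ x * spectralProj ρ y = if x = y then spectralProj ρ x else 0 := by
  conv_lhs => rw [spectralProj, cfc_mul_spectralProj]
  by_cases h : x = y
  · simp [h]
  · simp [h, Ne.symm h]

theorem mul_spectralProj (hρ : IsSelfAdjoint ρ) (x : ℝ) :
    ρ * spectralProj ρ x = x • spectralProj ρ x := by
  simpa [cfc_id' ℝ ρ] using cfc_mul_spectralProj (ρ := ρ) (fun y => y) x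

theorem spectralProj_mul (hρ : IsSelfAdjoint ρ) (x : ℝ) :
    spectralProj ρ x * ρ = x • spectralProj ρ x := by
  simpa [cfc_id' ℝ ρ] using spectralProj_mul_cfc (ρ := ρ) (fun y => y) x

theorem sum_spectralProj (hρ : IsSelfAdjoint ρ) : ∑ x ∈ specSet ρ, spectralProj ρ x = 1 := by
  have h := cfc_eq_sum_spectralProj ρ (fun _ => 1)
  rw [cfc_const_one ℝ ρ] at h
  simpa using h.symm

/-- Inserting the two resolutions of the identity reduces operator identities to scalar ones, one
for each pair of eigenvalues. -/
theorem eq_of_spectralProj_blocks (hρ : IsSelfAdjoint ρ) (hσ : IsSelfAdjoint σ) {A B : Op H}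
    (h : ∀ x ∈ specSet ρ, ∀ y ∈ specSet σ, spectralProj ρ x * A * spectralProj σ y =
      spectralProj ρ x * B * spectralProj σ y) : A = B := by
  have e : ∀ C : Op H, C = ∑ x ∈ specSet ρ, ∑ y ∈ specSet σ,
      spectralProj ρ x * C * spectralProj σ y := by
    intro C
    simp_rw [← Finset.mul_sum, ← Finset.sum_mul]
    rw [sum_spectralProj hρ, sum_spectralProj hσ, one_mul, mul_one]
  rw [e A, e B]
  exact Finset.sum_congr rfl fun x hx => Finset.sum_congr rfl fun y hy => h x hx y hy

theorem spectralProj_ne_zero (hρ : IsSelfAdjoint ρ) {x : ℝ} (hx : x ∈ spectrum ℝ ρ) :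
    spectralProj ρ x ≠ 0 := by
  intro h
  have h0 : cfc (fun y : ℝ => if y = x then (1 : ℝ) else 0) ρ = cfc (fun _ : ℝ => (0 : ℝ)) ρ := by
    rw [cfc_const_zero]
    exact h
  have := (cfc_eq_cfc_iff_eqOn (a := ρ) (hf := continuousOn_realSpectrum ρ _)
    (hg := continuousOn_realSpectrum ρ _)).1 h0 hx
  simp at this

theorem spectralProj_mul_modularCalc_mul (φ : ℝ → ℝ) (A : Op H) {x y : ℝ} (hx : x ∈ specSet ρ)
    (hy : y ∈ specSet ρ) :
    spectralProj ρ x * modularCalc φ ρ A * spectralProj ρ y =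
      φ (x / y) • (spectralProj ρ x * A * spectralProj ρ y) := by
  have h : ∀ a b, spectralProj ρ x * (φ (a / b) • (spectralProj ρ a * A * spectralProj ρ b)) *
      spectralProj ρ y = if x = a then if b = y then
        φ (a / b) • (spectralProj ρ a * A * spectralProj ρ b) else 0 else 0 := by
    intro a b
    rw [mul_smul_comm, smul_mul_assoc,
      show spectralProj ρ x * (spectralProj ρ a * A * spectralProj ρ b) * spectralProj ρ y =
        (spectralProj ρ x * spectralProj ρ a) * A * (spectralProj ρ b * spectralProj ρ y) by
        simp only [mul_assoc], spectralProj_mul_spectralProj, spectralProj_mul_spectralProj]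
    split_ifs with h1 h2 <;> simp [h1]
  simp only [modularCalc, Finset.mul_sum, Finset.sum_mul, h]
  rw [Finset.sum_eq_single x (fun a _ ha => by simp [Ne.symm ha]) (fun h => (h hx).elim),
    Finset.sum_eq_single y (fun b _ hb => by simp [hb]) (fun h => (h hy).elim)]
  simp

end Spectral

/-! ### Comparison of norm and trace -/

section NormTrace

open scoped ComplexOrder

variable {ρ σ : Op H}

theorem spectralProj_nonneg (x : ℝ) : 0 ≤ spectralProj ρ x :=
  cfc_nonneg fun y _ => by split_ifs <;> norm_num

/-- The trace of an idempotent is its rank, a natural number, and here it is nonzero. -/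
theorem one_le_re_tr_spectralProj (hρ : IsSelfAdjoint ρ) {x : ℝ} (hx : x ∈ spectrum ℝ ρ) :
    1 ≤ (tr (spectralProj ρ x)).re := by
  set P : H →ₗ[ℂ] H := (spectralProj ρ x : H →ₗ[ℂ] H) with hP
  have hidem : IsIdempotentElem P := by
    have h := spectralProj_mul_spectralProj (ρ := ρ) x x
    rw [if_pos rfl] at h
    exact congrArg (fun A : Op H => (A : H →ₗ[ℂ] H)) h
  have htr : tr (spectralProj ρ x) = (Module.finrank ℂ (LinearMap.range P) : ℂ) :=
    (LinearMap.IsIdempotentElem.isProj_range P hidem).trace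
  have hne : tr (spectralProj ρ x) ≠ 0 := fun h =>
    spectralProj_ne_zero hρ hx (ContinuousLinearMap.coe_injective
      ((LinearMap.IsIdempotentElem.trace_eq_zero_iff hidem).1 h))
  rw [htr] at hne ⊢
  have : Module.finrank ℂ (LinearMap.range P) ≠ 0 := by exact_mod_cast hne
  simpa using Nat.one_le_iff_ne_zero.2 this

theorem spectrum_le_re_tr (hρ : 0 ≤ ρ) {x : ℝ} (hx : x ∈ spectrum ℝ ρ) : x ≤ (tr ρ).re := by
  have hsa : IsSelfAdjoint ρ := .of_nonneg hρ
  have hpos : ∀ y ∈ spectrum ℝ ρ, 0 ≤ y := fun y hy => spectrum_nonneg_of_nonneg hρ hy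
  have h1 : (tr ρ).re = ∑ y ∈ specSet ρ, y * (tr (spectralProj ρ y)).re := by
    conv_lhs => rw [← cfc_id' ℝ ρ, cfc_eq_sum_spectralProj, tr_sum]
    simp [tr_real_smul]
  rw [h1]
  calc x ≤ x * (tr (spectralProj ρ x)).re :=
        le_mul_of_one_le_right (hpos x hx) (one_le_re_tr_spectralProj hsa hx)
    _ ≤ _ := Finset.single_le_sum (f := fun y => y * (tr (spectralProj ρ y)).re)
        (fun y hy => mul_nonneg (hpos y (by simpa using hy))
          (Complex.nonneg_iff.1 (tr_nonneg (spectralProj_nonneg y))).1) (by simpa using hx)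

theorem norm_le_re_tr {A : Op H} (hA : 0 ≤ A) : ‖A‖ ≤ (tr A).re := by
  have hsa : IsSelfAdjoint A := .of_nonneg hA
  rw [← cfc_id' ℝ A]
  refine (norm_cfc_le (Complex.nonneg_iff.1 (tr_nonneg hA)).1 fun x hx => ?_).trans
    (le_of_eq (by rw [cfc_id' ℝ A]))
  rw [Real.norm_of_nonneg (spectrum_nonneg_of_nonneg hA hx)]
  exact spectrum_le_re_tr hA hx

theorem sq_norm_le_re_tr (A : Op H) : ‖A‖ ^ 2 ≤ (tr (star A * A)).re := by
  rw [sq, ← CStarRing.norm_star_mul_self]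
  exact norm_le_re_tr (star_mul_self_nonneg A)

/-- The trace form is nondegenerate. -/
theorem eq_of_tr_mul_eq {A B : Op H} (h : ∀ f, tr (A * f) = tr (B * f)) : A = B := by
  have h1 := sq_norm_le_re_tr (A - B)
  rw [tr_mul_comm, sub_mul, tr_sub, h, sub_self, Complex.zero_re] at h1
  rw [← sub_eq_zero, ← norm_eq_zero]
  nlinarith [norm_nonneg (A - B)]

end NormTrace

/-! ### Relative entropy -/

section RelEntropy

open scoped ComplexOrder

variable {ρ σ : Op H}

/-- The weights `Tr (P_x(ρ) P_y(σ))` are nonnegative and do not depend on `g` and `h`, so trace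
inequalities between noncommuting `ρ` and `σ` can be checked pointwise in `(x, y)`. -/
theorem re_tr_cfc_mul_cfc (ρ σ : Op H) (g h : ℝ → ℝ) :
    (tr (cfc g ρ * cfc h σ)).re = ∑ x ∈ specSet ρ, ∑ y ∈ specSet σ,
      g x * h y * (tr (spectralProj ρ x * spectralProj σ y)).re := by
  rw [cfc_eq_sum_spectralProj ρ, cfc_eq_sum_spectralProj σ]
  simp only [Finset.sum_mul, Finset.mul_sum, tr_sum, Complex.re_sum]
  rw [Finset.sum_comm]
  refine Finset.sum_congr rfl fun x _ => Finset.sum_congr rfl fun y _ => ?_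
  rw [smul_mul_smul_comm, tr_real_smul, Complex.re_ofReal_mul]

/-- With `p = a²` and `q = b²`, the bound `log (b/a) ≤ b/a - 1` shows that the right side is at
least `(a - b)²`, while `(p - q)² = (a + b)² (a - b)² ≤ 4 (a - b)²`. -/
theorem quarter_sq_sub_le_mul_log {p q : ℝ} (hp : 0 < p) (hp1 : p ≤ 1) (hq : 0 < q) (hq1 : q ≤ 1) :
    (1 / 4) * (p - q) ^ 2 ≤ p * Real.log p - p * Real.log q - p + q := by
  obtain ⟨a, ha, rfl⟩ : ∃ a : ℝ, 0 < a ∧ p = a ^ 2 :=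
    ⟨√p, Real.sqrt_pos.2 hp, (Real.sq_sqrt hp.le).symm⟩
  obtain ⟨b, hb, rfl⟩ : ∃ b : ℝ, 0 < b ∧ q = b ^ 2 :=
    ⟨√q, Real.sqrt_pos.2 hq, (Real.sq_sqrt hq.le).symm⟩
  have ha1 : a ≤ 1 := by nlinarith
  have hb1 : b ≤ 1 := by nlinarith
  have hlog := Real.log_le_sub_one_of_pos (div_pos hb ha)
  rw [Real.log_div hb.ne' ha.ne'] at hlog
  have h2 : a ^ 2 * (Real.log b - Real.log a) ≤ a * b - a ^ 2 := by
    calc a ^ 2 * (Real.log b - Real.log a) ≤ a ^ 2 * (b / a - 1) := by gcongr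
      _ = a * b - a ^ 2 := by field_simp
  rw [Real.log_pow, Real.log_pow]
  push_cast
  have h3 : (a ^ 2 - b ^ 2) ^ 2 ≤ 4 * (a - b) ^ 2 := by
    have : (a + b) ^ 2 ≤ 4 := by nlinarith
    calc (a ^ 2 - b ^ 2) ^ 2 = (a + b) ^ 2 * (a - b) ^ 2 := by ring
      _ ≤ 4 * (a - b) ^ 2 := by gcongr
  nlinarith

/-- A Pinsker-type inequality for the relative entropy. -/
theorem sq_norm_sub_le_relEntropy (hρ : IsFullRankState ρ) (hσ : IsFullRankState σ) :
    (1 / 4) * ‖ρ - σ‖ ^ 2 ≤ relEntropy ρ σ := by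
  have sρ := hρ.1.isSelfAdjoint
  have sσ := hσ.1.isSelfAdjoint
  have e1 : ∀ g, (tr (cfc g ρ)).re = ∑ x ∈ specSet ρ, ∑ y ∈ specSet σ,
      g x * (tr (spectralProj ρ x * spectralProj σ y)).re := by
    intro g
    have h := re_tr_cfc_mul_cfc ρ σ g (fun _ => 1)
    rw [cfc_const_one ℝ σ, mul_one] at h
    simpa using h
  have e2 : ∀ g, (tr (cfc g σ)).re = ∑ x ∈ specSet ρ, ∑ y ∈ specSet σ,
      g y * (tr (spectralProj ρ x * spectralProj σ y)).re := by
    intro g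
    have h := re_tr_cfc_mul_cfc ρ σ (fun _ => 1) g
    rw [cfc_const_one ℝ ρ, one_mul] at h
    simpa using h
  have cρ : ∀ g, ContinuousOn g (spectrum ℝ ρ) := continuousOn_realSpectrum ρ
  have cσ : ∀ g, ContinuousOn g (spectrum ℝ σ) := continuousOn_realSpectrum σ
  have t1 : (tr (ρ * opLog ρ)).re = ∑ x ∈ specSet ρ, ∑ y ∈ specSet σ,
      x * Real.log x * (tr (spectralProj ρ x * spectralProj σ y)).re := by
    rw [← e1 (fun x => x * Real.log x), cfc_mul (fun x => x) Real.log ρ (cρ _) (cρ _),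
      cfc_id' ℝ ρ, opLog]
  have t2 : (tr (ρ * opLog σ)).re = ∑ x ∈ specSet ρ, ∑ y ∈ specSet σ,
      x * Real.log y * (tr (spectralProj ρ x * spectralProj σ y)).re := by
    rw [← re_tr_cfc_mul_cfc ρ σ (fun x => x) Real.log, cfc_id' ℝ ρ, opLog]
  have t3 := e1 (fun x => x)
  have t4 := e2 (fun x => x)
  have t5 := e1 (fun x => x * x)
  have t6 := e2 (fun x => x * x)
  have t7 := re_tr_cfc_mul_cfc ρ σ (fun x => x) (fun x => x)
  rw [cfc_mul (fun x => x) (fun x => x) ρ (cρ _) (cρ _)] at t5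
  rw [cfc_mul (fun x => x) (fun x => x) σ (cσ _) (cσ _)] at t6
  rw [cfc_id' ℝ ρ] at t3 t5 t7
  rw [cfc_id' ℝ σ] at t4 t6 t7
  have hsq := sq_norm_le_re_tr (ρ - σ)
  rw [(sρ.sub sσ).star_eq, show (ρ - σ) * (ρ - σ) = ρ * ρ - ρ * σ - (σ * ρ - σ * σ) by noncomm_ring,
    tr_sub, tr_sub, tr_sub, tr_mul_comm σ ρ, Complex.sub_re, Complex.sub_re, Complex.sub_re] at hsq
  -- The traces cancel; they supply the terms `-p + q` of the scalar inequality.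
  have hD : relEntropy ρ σ = (tr (ρ * opLog ρ)).re - (tr (ρ * opLog σ)).re - (tr ρ).re
      + (tr σ).re := by
    rw [relEntropy, mul_sub, tr_sub, Complex.sub_re, hρ.2, hσ.2]
    ring
  rw [hD]
  refine (mul_le_mul_of_nonneg_left hsq (by norm_num)).trans ?_
  rw [t1, t2, t3, t4, t5, t6, t7]
  simp only [← Finset.sum_sub_distrib, ← Finset.sum_add_distrib, Finset.mul_sum]
  refine Finset.sum_le_sum fun x hx => Finset.sum_le_sum fun y hy => ?_
  have hx' : x ∈ spectrum ℝ ρ := by simpa using hx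
  have hy' : y ∈ spectrum ℝ σ := by simpa using hy
  have hw : 0 ≤ (tr (spectralProj ρ x * spectralProj σ y)).re :=
    (Complex.nonneg_iff.1 (tr_mul_nonneg (spectralProj_nonneg x) (spectralProj_nonneg y))).1
  have hx1 := spectrum_le_re_tr hρ.1.nonneg hx'
  have hy1 := spectrum_le_re_tr hσ.1.nonneg hy'
  rw [hρ.2, Complex.one_re] at hx1
  rw [hσ.2, Complex.one_re] at hy1
  have := mul_le_mul_of_nonneg_right
    (quarter_sq_sub_le_mul_log (hρ.1.spectrum_pos hx') hx1 (hσ.1.spectrum_pos hy') hy1) hw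
  linarith

theorem relEntropy_nonneg (hρ : IsFullRankState ρ) (hσ : IsFullRankState σ) :
    0 ≤ relEntropy ρ σ :=
  le_trans (by positivity) (sq_norm_sub_le_relEntropy hρ hσ)

theorem isSelfAdjoint_opLog (ρ : Op H) : IsSelfAdjoint (opLog ρ) := cfc_predicate _ ρ

theorem continuousOn_opLog : ContinuousOn (opLog (H := H)) {ρ | IsStrictlyPositive ρ} :=
  CFC.continuousOn_log.mono fun _ h => ⟨h.isSelfAdjoint, h.isUnit⟩

/-- The gap between the two sides is `D(τ‖ρ) ≥ 0`. This is the tangent-plane inequality for the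
convex function `D(·‖σ)`. -/
theorem tr_mul_opLog_sub_le_relEntropy_sub {τ : Op H} (hρ : IsFullRankState ρ)
    (hτ : IsFullRankState τ) :
    (tr ((τ - ρ) * (opLog ρ - opLog σ))).re ≤ relEntropy τ σ - relEntropy ρ σ := by
  have h := relEntropy_nonneg hτ hρ
  simp only [relEntropy, mul_sub, sub_mul, tr_sub, Complex.sub_re] at h ⊢
  linarith

/-- The derivative of the relative entropy along a differentiable path of full-rank states. -/
theorem hasDerivWithinAt_relEntropy {γ : ℝ → Op H} {γ' : Op H} {s : Set ℝ} {t : ℝ} (ht : t ∈ s)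
    (hγ : ∀ u ∈ s, IsFullRankState (γ u)) (hd : HasDerivWithinAt γ γ' s t) :
    HasDerivWithinAt (fun u => relEntropy (γ u) σ)
      (tr (γ' * (opLog (γ t) - opLog σ))).re s t := by
  set X : ℝ → Op H := fun u => opLog (γ u) - opLog σ with hX
  have hXc : Filter.Tendsto X (nhdsWithin t (s \ {t})) (nhds (X t)) := by
    have h1 : ContinuousWithinAt (fun u => opLog (γ u)) s t :=
      (continuousOn_opLog _ (hγ t ht).1).comp hd.continuousWithinAt fun u hu => (hγ u hu).1
    exact (h1.mono Set.sdiff_subset).sub tendsto_const_nhds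
  rw [hasDerivWithinAt_iff_tendsto_slope] at hd ⊢
  have key : ∀ Y : ℝ → Op H, Filter.Tendsto Y (nhdsWithin t (s \ {t})) (nhds (X t)) →
      Filter.Tendsto (fun u => (tr (slope γ t u * Y u)).re) (nhdsWithin t (s \ {t}))
        (nhds (tr (γ' * X t)).re) := fun Y hY =>
    ((Complex.continuous_re.comp (trCLM H).continuous).tendsto _).comp (hd.mul hY)
  have e : ∀ u, ∀ Z : Op H, (tr (slope γ t u * Z)).re = (u - t)⁻¹ * (tr ((γ u - γ t) * Z)).re := by
    intro u Z
    rw [slope_def_module, smul_mul_assoc, tr_real_smul, Complex.re_ofReal_mul]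
  -- The tangent inequality at `γ t` and at `γ u` encloses the slope, so only continuity of the
  -- logarithm is needed, not its derivative. Dividing by `u - t` swaps the two bounds when `u < t`,
  -- hence the case distinction.
  refine tendsto_of_tendsto_of_tendsto_of_le_of_le' (key (fun u => if t < u then X t else X u) ?_)
    (key (fun u => if t < u then X u else X t) ?_) ?_ ?_
  · exact tendsto_const_nhds.if' hXc
  · exact hXc.if' tendsto_const_nhds
  all_goals
    filter_upwards [self_mem_nhdsWithin] with u hu
    have l := tr_mul_opLog_sub_le_relEntropy_sub (σ := σ) (hγ t ht) (hγ u hu.1)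
    have r := tr_mul_opLog_sub_le_relEntropy_sub (σ := σ) (hγ u hu.1) (hγ t ht)
    rw [← neg_sub (γ u), neg_mul, tr_neg, Complex.neg_re] at r
    rw [e, slope_def_module, smul_eq_mul]
    split_ifs with h
    · exact mul_le_mul_of_nonneg_left (by linarith) (inv_nonneg.2 (sub_nonneg.2 h.le))
    · exact mul_le_mul_of_nonpos_left (by linarith) (inv_nonpos.2 (sub_nonpos.2 (not_lt.1 h)))

end RelEntropy

/-! ### Operators intertwining with the functional calculus -/

section Intertwining

variable {ρ σ L : Op H}

/-- The hypothesis forces the block `P_x L P_y` to vanish unless `x = c y`. -/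
theorem cfc_mul_eq_mul_cfc_of_intertwine (hσ : IsSelfAdjoint σ) {c : ℝ}
    (h : σ * L = c • (L * σ)) (g : ℝ → ℝ) :
    cfc g σ * L = L * cfc (fun y => g (c * y)) σ := by
  refine eq_of_spectralProj_blocks hσ hσ fun x _ y _ => ?_
  have h1 : (x - c * y) • (spectralProj σ x * L * spectralProj σ y) = 0 := by
    have h2 := congrArg (fun A => spectralProj σ x * A * spectralProj σ y) h
    simp only [mul_smul_comm, smul_mul_assoc] at h2
    rw [← mul_assoc, spectralProj_mul hσ, ← mul_assoc, mul_assoc _ σ, mul_spectralProj hσ] at h2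
    simp only [mul_smul_comm, smul_mul_assoc, smul_smul] at h2
    rw [sub_smul, h2, sub_self]
  rw [← mul_assoc, spectralProj_mul_cfc, ← mul_assoc, mul_assoc _ (cfc _ σ), cfc_mul_spectralProj,
    mul_smul_comm, smul_mul_assoc, smul_mul_assoc]
  rcases smul_eq_zero.1 h1 with h2 | h2
  · rw [sub_eq_zero.1 h2]
  · rw [h2, smul_zero, smul_zero]

theorem mul_opLog_sub_opLog_mul (hσ : IsStrictlyPositive σ) {ω : ℝ}
    (h : σ * L = Real.exp (-ω) • (L * σ)) : L * opLog σ - opLog σ * L = ω • L := by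
  have h1 : cfc (fun y => Real.log (Real.exp (-ω) * y)) σ = cfc (fun y => -ω + Real.log y) σ :=
    cfc_congr fun y hy => by
      rw [Real.log_mul (Real.exp_pos _).ne' (hσ.spectrum_pos hy).ne', Real.log_exp]
  rw [opLog, cfc_mul_eq_mul_cfc_of_intertwine hσ.isSelfAdjoint h, h1,
    cfc_const_add (-ω) Real.log σ (continuousOn_realSpectrum σ _) hσ.isSelfAdjoint, mul_add,
    Algebra.algebraMap_eq_smul_one, mul_smul_comm, mul_one, neg_smul]
  abel

theorem opPow_mul_of_intertwine (hσ : IsStrictlyPositive σ) {ω : ℝ}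
    (h : σ * L = Real.exp (-ω) • (L * σ)) (s : ℝ) :
    opPow σ s * L = Real.exp (-ω * s) • (L * opPow σ s) := by
  have h1 : cfc (fun y => (Real.exp (-ω) * y) ^ s) σ =
      cfc (fun y => Real.exp (-ω * s) • y ^ s) σ :=
    cfc_congr fun y hy => by
      simp only [smul_eq_mul]
      rw [Real.mul_rpow (Real.exp_pos _).le (hσ.spectrum_pos hy).le, ← Real.exp_mul]
  rw [opPow, cfc_mul_eq_mul_cfc_of_intertwine hσ.isSelfAdjoint h, h1,
    cfc_smul _ _ σ (continuousOn_realSpectrum σ _), mul_smul_comm]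

theorem opPow_mul_opPow_neg (hσ : IsStrictlyPositive σ) (s : ℝ) :
    opPow σ s * opPow σ (-s) = 1 := by
  rw [opPow, opPow, ← cfc_mul _ _ σ (continuousOn_realSpectrum σ _) (continuousOn_realSpectrum σ _),
    ← cfc_const_one ℝ σ hσ.isSelfAdjoint]
  refine cfc_congr fun y hy => ?_
  have hy := hσ.spectrum_pos hy
  rw [← Real.rpow_add hy, add_neg_cancel, Real.rpow_zero]

/-- The noncommutative chain rule `[ρ]_ω ([L, log ρ] - ω L) = e^{-ω/2} L ρ - e^{ω/2} ρ L`. -/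
theorem bracket_comm_opLog_sub (hρ : IsStrictlyPositive ρ) (ω : ℝ) (L : Op H) :
    bracket ρ ω (comm L (opLog ρ) - ω • L) =
      Real.exp (-ω / 2) • (L * ρ) - Real.exp (ω / 2) • (ρ * L) := by
  have sρ := hρ.isSelfAdjoint
  refine eq_of_spectralProj_blocks sρ sρ fun x hx y hy => ?_
  have hx0 : 0 < x := hρ.spectrum_pos (by simpa using hx)
  have hy0 : 0 < y := hρ.spectrum_pos (by simpa using hy)
  have e1 : spectralProj ρ x * (comm L (opLog ρ) - ω • L) * spectralProj ρ y =
      (Real.log y - Real.log x - ω) • (spectralProj ρ x * L * spectralProj ρ y) := by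
    simp only [comm, mul_sub, sub_mul, sub_smul, mul_smul_comm, smul_mul_assoc]
    rw [← mul_assoc, ← mul_assoc, mul_assoc _ (opLog ρ) (spectralProj ρ y), opLog,
      cfc_mul_spectralProj, spectralProj_mul_cfc, smul_mul_assoc, smul_mul_assoc, mul_smul_comm]
  have e2 : spectralProj ρ x * (Real.exp (-ω / 2) • (L * ρ) - Real.exp (ω / 2) • (ρ * L)) *
      spectralProj ρ y = (Real.exp (-ω / 2) * y - Real.exp (ω / 2) * x) •
        (spectralProj ρ x * L * spectralProj ρ y) := by
    simp only [mul_sub, sub_mul, sub_smul, mul_smul_comm, smul_mul_assoc]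
    rw [← mul_assoc, ← mul_assoc, mul_assoc _ ρ (spectralProj ρ y), mul_spectralProj sρ,
      spectralProj_mul sρ, smul_mul_assoc, smul_mul_assoc, mul_smul_comm, smul_smul, smul_smul]
  rw [bracket, ← mul_assoc, mul_assoc _ ρ, mul_spectralProj sρ, mul_smul_comm,
    spectralProj_mul_modularCalc_mul _ _ hx hy, e1, e2, smul_smul, smul_smul]
  congr 1
  have hexp : Real.exp (ω / 2) * Real.exp (-ω) = Real.exp (-ω / 2) := by
    rw [← Real.exp_add]
    ring_nf
  rw [fOmega, Real.log_div hx0.ne' hy0.ne']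
  split_ifs with h
  -- At the removable singularity the logarithmic factor and the right side both vanish, so the
  -- value of `fOmega` there plays no role.
  · have h1 : Real.log x - Real.log y = -ω := by
      rw [← Real.log_div hx0.ne' hy0.ne', h, Real.log_exp]
    rw [show Real.log y - Real.log x - ω = 0 by linarith, mul_zero, ← hexp, ← h]
    field_simp
    ring
  · have h1 : Real.log x - Real.log y + ω ≠ 0 := by
      intro h0
      apply h
      rw [← Real.exp_log (div_pos hx0 hy0), Real.log_div hx0.ne' hy0.ne']
      congr 1
      linarith
    rw [← hexp]
    have h2 : Real.log y - Real.log x - ω = -(Real.log x - Real.log y + ω) := by ring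
    rw [h2]
    field_simp
    ring

theorem bracket_smul (ρ : Op H) (ω r : ℝ) (A : Op H) :
    bracket ρ ω (r • A) = r • bracket ρ ω A := by
  simp only [bracket, modularCalc, mul_smul_comm, smul_mul_assoc, smul_comm _ r, Finset.smul_sum,
    Finset.sum_mul]

end Intertwining

/-! ### The generator in the Schrödinger picture -/

namespace Rep

variable {J : Type*} [Fintype J] {R : Rep H J} {ρ σ : Op H}

/-- The generator in the Schrödinger picture. -/
def dual (R : Rep H J) (ρ : Op H) : Op H :=
  ∑ j, R.c j • (Real.exp (-R.ω j / 2) • (R.L j * ρ * star (R.L j) - star (R.L j) * R.L j * ρ) +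
    Real.exp (R.ω j / 2) • (star (R.L j) * ρ * R.L j - ρ * R.L j * star (R.L j)))

/-- The Schrödinger generator as a continuous linear map. -/
def dualCLM (R : Rep H J) : Op H →L[ℝ] Op H :=
  LinearMap.toContinuousLinearMap (E := Op H) (𝕜 := ℂ)
    { toFun := R.dual
      map_add' := fun A B => by
        simp only [dual, ← Finset.sum_add_distrib, mul_add, add_mul, ← smul_add]
        refine Finset.sum_congr rfl fun j _ => ?_
        congr 1
        module
      map_smul' := fun z A => by
        simp only [dual, Finset.smul_sum, mul_smul_comm, smul_mul_assoc, RingHom.id_apply]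
        refine Finset.sum_congr rfl fun j _ => ?_
        module } |>.restrictScalars ℝ

theorem dualCLM_apply (A : Op H) : R.dualCLM A = R.dual A := rfl

namespace IsDetailedBalance

variable (hR : R.IsDetailedBalance σ)
include hR

theorem intertwine (hσ : IsStrictlyPositive σ) (j : J) :
    σ * R.L j = Real.exp (-R.ω j) • (R.L j * σ) := by
  rw [← smul_mul_assoc, ← hR.modular j, mul_assoc, Ring.inverse_mul_cancel σ hσ.isUnit, mul_one]

theorem intertwine_star (hσ : IsStrictlyPositive σ) (j : J) :
    σ * star (R.L j) = Real.exp (-(-R.ω j)) • (star (R.L j) * σ) := by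
  have h := congrArg star (hR.intertwine hσ j)
  rw [star_mul, hσ.isSelfAdjoint.star_eq, star_smul, star_mul, hσ.isSelfAdjoint.star_eq] at h
  rw [h, star_trivial (Real.exp (-R.ω j)), smul_smul, ← Real.exp_add]
  simp

theorem L_injective : Function.Injective R.L := by
  intro j k h
  by_contra hne
  have h1 := hR.orthonormal_self j
  have h2 := hR.orthogonal j k hne
  rw [← h, h1] at h2
  exact one_ne_zero h2

theorem L_ne_zero (j : J) : R.L j ≠ 0 := by
  intro h
  have h1 := hR.orthonormal_self j
  rw [h, hsInner, mul_zero, ← trCLM_apply, map_zero, zero_div] at h1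
  exact zero_ne_one h1

/-- The adjoint permutes the `L_j`, preserves `c_j` and flips the sign of `ω_j`. In `tr_dual_mul`
this identifies the drift coefficients that cyclicity of the trace would otherwise exchange. -/
theorem sum_star_mul_eq (hσ : IsStrictlyPositive σ) :
    ∑ j, (R.c j * Real.exp (-R.ω j / 2)) • (star (R.L j) * R.L j) =
      ∑ j, (R.c j * Real.exp (R.ω j / 2)) • (R.L j * star (R.L j)) := by
  have hex : ∀ j, ∃ k, R.L k = star (R.L j) := fun j => by
    have : star (R.L j) ∈ Set.range R.L := hR.star_closed ▸ ⟨j, rfl⟩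
    exact this
  choose π hπ using hex
  have hinj : Function.Injective π := fun j k h =>
    hR.L_injective (star_injective ((hπ j).symm.trans ((congrArg R.L h).trans (hπ k))))
  refine Fintype.sum_bijective π (Finite.injective_iff_bijective.1 hinj) _ _ fun j => ?_
  have hω : R.ω (π j) = -R.ω j := by
    have h1 := hR.intertwine hσ (π j)
    rw [hπ, hR.intertwine_star hσ j] at h1
    have h2 : star (R.L j) * σ ≠ 0 := by
      intro h0
      exact hR.L_ne_zero j (star_eq_zero.1 (hσ.isUnit.mul_left_eq_zero.1 h0))
    have h3 := Real.exp_injective (smul_left_injective ℝ h2 h1)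
    linarith
  rw [hω, hπ, star_star, hR.c_symm j (π j) (hπ j).symm]

/-- The Schrödinger generator is the adjoint of the generator for the trace pairing. -/
theorem tr_dual_mul (hσ : IsStrictlyPositive σ) (ρ f : Op H) :
    tr (R.dual ρ * f) = tr (ρ * R.generator f) := by
  obtain ⟨B, hB⟩ : ∃ B, B = ∑ j, (R.c j * Real.exp (-R.ω j / 2)) • (star (R.L j) * R.L j) :=
    ⟨_, rfl⟩
  obtain ⟨B', hB'⟩ : ∃ B', B' = ∑ j, (R.c j * Real.exp (R.ω j / 2)) • (R.L j * star (R.L j)) :=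
    ⟨_, rfl⟩
  have hBB' : B' = B := by rw [hB, hB', hR.sum_star_mul_eq hσ]
  have e1 : R.dual ρ * f = (∑ j, R.c j • (Real.exp (-R.ω j / 2) • (R.L j * ρ * star (R.L j) * f) +
      Real.exp (R.ω j / 2) • (star (R.L j) * ρ * R.L j * f))) - B * ρ * f - ρ * B' * f := by
    rw [hB, hB']
    simp only [dual, Finset.sum_mul, Finset.mul_sum, ← Finset.sum_sub_distrib]
    refine Finset.sum_congr rfl fun j _ => ?_
    simp only [smul_add, smul_sub, add_mul, sub_mul, smul_mul_assoc, mul_smul_comm, smul_smul,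
      mul_assoc]
    abel
  have e2 : ρ * R.generator f = (∑ j, R.c j • (Real.exp (-R.ω j / 2) •
      (ρ * star (R.L j) * f * R.L j) + Real.exp (R.ω j / 2) • (ρ * R.L j * f * star (R.L j))))
      - ρ * B * f - ρ * f * B' := by
    rw [hB, hB']
    simp only [generator, comm, Finset.sum_mul, Finset.mul_sum, ← Finset.sum_sub_distrib]
    refine Finset.sum_congr rfl fun j _ => ?_
    simp only [smul_add, smul_sub, mul_add, mul_sub, sub_mul, smul_mul_assoc, mul_smul_comm,
      smul_smul, mul_assoc]
    abel
  rw [hBB'] at e1 e2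
  rw [e1, e2, tr_sub, tr_sub, tr_sub, tr_sub, tr_sum, tr_sum,
    show tr (ρ * f * B) = tr (B * ρ * f) by rw [tr_mul_comm, mul_assoc], sub_right_comm]
  congr 2
  refine Finset.sum_congr rfl fun j _ => ?_
  simp only [tr_real_smul, tr_add]
  rw [show tr (R.L j * ρ * star (R.L j) * f) = tr (ρ * star (R.L j) * f * R.L j) by
      rw [tr_mul_comm (ρ * star (R.L j) * f)]; simp only [mul_assoc],
    show tr (star (R.L j) * ρ * R.L j * f) = tr (ρ * R.L j * f * star (R.L j)) by
      rw [tr_mul_comm (ρ * R.L j * f)]; simp only [mul_assoc]]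

end IsDetailedBalance

end Rep

/-! ### The gradient flow structure -/

namespace Rep

variable {J : Type*} [Fintype J] {R : Rep H J} {ρ σ : Op H}

theorem Gam_GamInv (hσ : IsStrictlyPositive σ) (ρ : Op H) : Gam σ (GamInv σ ρ) = ρ := by
  have h1 := opPow_mul_opPow_neg hσ (1 / 2)
  have h2 := opPow_mul_opPow_neg hσ (-1 / 2)
  rw [show -(1 / 2 : ℝ) = -1 / 2 by norm_num] at h1
  rw [show -(-1 / 2 : ℝ) = 1 / 2 by norm_num] at h2
  rw [Gam, GamInv, ← mul_assoc, ← mul_assoc, h1, one_mul, mul_assoc, h2, mul_one]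

/-- Applied with `S = σ^{1/2}`, `T = σ^{-1/2}`, `L' = L^*`, `a = e^{-ω/2}`, `b = e^{ω/2}`. Commuting
`S` and `T` past `L` and `L'` until they cancel costs factors `a` and `b`; the sandwich terms pick
up `b²` or `a²`, which exchanges their weights. -/
theorem conj_generator_term {S T L L' ρ : Op H} {a b : ℝ} (hab : a * b = 1) (hST : S * T = 1)
    (hTS : T * S = 1) (h1 : S * L = a • (L * S)) (h2 : T * L = b • (L * T))
    (h3 : S * L' = b • (L' * S)) (h4 : T * L' = a • (L' * T)) :
    S * (a • (L' * comm (T * ρ * T) L) + b • (comm L (T * ρ * T) * L')) * S =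
      a • (L * ρ * L' - L' * L * ρ) + b • (L' * ρ * L - ρ * L * L') := by
  have e1 : S * (L' * (T * ρ * T * L)) * S = (b * b) • (L' * ρ * L) := by
    calc S * (L' * (T * ρ * T * L)) * S = (S * L') * (T * ρ) * (T * L) * S := by
          simp only [mul_assoc]
      _ = (b * b) • (L' * (S * T) * ρ * L * (T * S)) := by
          rw [h3, h2]
          simp only [smul_mul_assoc, mul_smul_comm, smul_smul, mul_assoc]
      _ = _ := by rw [hST, hTS, mul_one, mul_one]
  have e2 : S * (L' * (L * (T * ρ * T))) * S = L' * L * ρ := by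
    calc S * (L' * (L * (T * ρ * T))) * S = (S * L') * L * T * ρ * (T * S) := by
          simp only [mul_assoc]
      _ = b • (L' * (S * L) * T * ρ) := by
          rw [h3, hTS]
          simp only [smul_mul_assoc, mul_assoc, mul_one]
      _ = (a * b) • (L' * L * (S * T) * ρ) := by
          rw [h1]
          simp only [smul_mul_assoc, mul_smul_comm, smul_smul, mul_assoc, mul_comm a b]
      _ = _ := by rw [hST, hab, one_smul, mul_one]
  have e3 : S * (L * (T * ρ * T) * L') * S = (a * a) • (L * ρ * L') := by
    calc S * (L * (T * ρ * T) * L') * S = (S * L) * (T * ρ) * (T * L') * S := by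
          simp only [mul_assoc]
      _ = (a * a) • (L * (S * T) * ρ * L' * (T * S)) := by
          rw [h1, h4]
          simp only [smul_mul_assoc, mul_smul_comm, smul_smul, mul_assoc]
      _ = _ := by rw [hST, hTS, mul_one, mul_one]
  have e4 : S * ((T * ρ * T) * L * L') * S = ρ * L * L' := by
    calc S * ((T * ρ * T) * L * L') * S = (S * T) * ρ * (T * L) * L' * S := by
          simp only [mul_assoc]
      _ = b • (ρ * L * (T * L') * S) := by
          rw [h2, hST]
          simp only [smul_mul_assoc, mul_smul_comm, mul_assoc, one_mul]
      _ = (a * b) • (ρ * L * L' * (T * S)) := by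
          rw [h4]
          simp only [smul_mul_assoc, mul_smul_comm, smul_smul, mul_assoc, mul_comm a b]
      _ = _ := by rw [hTS, hab, one_smul, mul_one]
  simp only [comm, mul_add, add_mul, mul_sub, sub_mul, mul_smul_comm, smul_mul_assoc]
  simp only [mul_assoc] at e1 e2 e3 e4 ⊢
  rw [e1, e2, e3, e4]
  simp only [smul_sub, smul_smul]
  rw [show a * (b * b) = b by rw [← mul_assoc, hab, one_mul],
    show b * (a * a) = a by rw [← mul_assoc, mul_comm b, hab, one_mul]]
  abel

namespace IsDetailedBalance

variable (hR : R.IsDetailedBalance σ)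
include hR

/-- This is KMS symmetry of the generator; it lets the entropy production be read off from the
Schrödinger generator. -/
theorem Gam_generator_GamInv (hσ : IsStrictlyPositive σ) (ρ : Op H) :
    Gam σ (R.generator (GamInv σ ρ)) = R.dual ρ := by
  have hST := opPow_mul_opPow_neg hσ (1 / 2)
  have hTS := opPow_mul_opPow_neg hσ (-1 / 2)
  rw [show -(1 / 2 : ℝ) = -1 / 2 by norm_num] at hST
  rw [show -(-1 / 2 : ℝ) = 1 / 2 by norm_num] at hTS
  simp only [Gam, GamInv, generator, dual, Finset.mul_sum, Finset.sum_mul, mul_smul_comm,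
    smul_mul_assoc]
  refine Finset.sum_congr rfl fun j _ => ?_
  have h1 := opPow_mul_of_intertwine hσ (hR.intertwine hσ j) (1 / 2)
  have h2 := opPow_mul_of_intertwine hσ (hR.intertwine hσ j) (-1 / 2)
  have h3 := opPow_mul_of_intertwine hσ (hR.intertwine_star hσ j) (1 / 2)
  have h4 := opPow_mul_of_intertwine hσ (hR.intertwine_star hσ j) (-1 / 2)
  rw [show -R.ω j * (1 / 2) = -R.ω j / 2 by ring] at h1
  rw [show -R.ω j * (-1 / 2) = R.ω j / 2 by ring] at h2
  rw [show - -R.ω j * (1 / 2) = R.ω j / 2 by ring] at h3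
  rw [show - -R.ω j * (-1 / 2) = -R.ω j / 2 by ring] at h4
  rw [conj_generator_term (by rw [← Real.exp_add]; ring_nf; exact Real.exp_zero)
    hST hTS h1 h2 h3 h4]

theorem entropyProduction_eq (hσ : IsStrictlyPositive σ) (ρ : Op H) :
    entropyProduction R.generator σ ρ = -(tr (R.dual ρ * (opLog ρ - opLog σ))).re := by
  rw [entropyProduction, dirichletOne, hR.Gam_generator_GamInv hσ, Gam_GamInv hσ]
  ring

/-- By modular covariance `[L_j, log σ] = ω_j L_j`, which is exactly the shift that the chain rule
requires. -/
theorem bracket_grad (hσ : IsStrictlyPositive σ) (hρ : IsStrictlyPositive ρ) (j : J) :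
    bracket ρ (R.ω j) (R.grad (opLog ρ - opLog σ) j) =
      Real.exp (-R.ω j / 2) • (R.L j * ρ) - Real.exp (R.ω j / 2) • (ρ * R.L j) := by
  rw [← bracket_comm_opLog_sub hρ, ← mul_opLog_sub_opLog_mul hσ (hR.intertwine hσ j)]
  congr 1
  simp only [grad, comm]
  noncomm_ring

/-- The Schrödinger flow is the gradient flow of the relative entropy. -/
theorem div_bracket_grad (hσ : IsStrictlyPositive σ) (hρ : IsStrictlyPositive ρ) :
    R.div (fun j => bracket ρ (R.ω j) (R.grad (opLog ρ - opLog σ) j)) = R.dual ρ := by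
  simp only [div, dual, hR.bracket_grad hσ hρ, comm]
  refine Finset.sum_congr rfl fun j _ => ?_
  simp only [sub_mul, mul_sub, smul_mul_assoc, mul_smul_comm, smul_sub, smul_add, mul_assoc]
  abel

end IsDetailedBalance

/-- Integration by parts. -/
theorem normSq_grad_eq {U : Op H} (hU : IsSelfAdjoint U) :
    R.normSq ρ (R.grad U) =
      -(tr (R.div (fun j => bracket ρ (R.ω j) (R.grad U j)) * U)).re := by
  simp only [normSq, div, Finset.sum_mul, tr_sum, smul_mul_assoc, tr_real_smul]
  rw [← Complex.neg_re, ← Finset.sum_neg_distrib]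
  congr 1
  refine Finset.sum_congr rfl fun j _ => ?_
  rw [← mul_neg]
  congr 1
  generalize bracket ρ (R.ω j) (R.grad U j) = A
  simp only [hsInner, grad, comm, star_sub, star_mul, hU.star_eq, sub_mul, tr_sub, neg_sub]
  rw [tr_mul_comm (star (R.L j) * A) U, ← mul_assoc, tr_mul_comm (A * star (R.L j)) U,
    mul_assoc (star (R.L j)), tr_mul_comm (star (R.L j)), mul_assoc, mul_assoc]

/-- The traceless part of `log ρ - log σ`. -/
def potential (ρ σ : Op H) : Op H :=
  opLog ρ - opLog σ - ((tr (opLog ρ - opLog σ)).re / Module.finrank ℂ H) • 1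

theorem isSelfAdjoint_potential (ρ σ : Op H) : IsSelfAdjoint (potential ρ σ) :=
  ((isSelfAdjoint_opLog ρ).sub (isSelfAdjoint_opLog σ)).sub
    (IsSelfAdjoint.smul (IsSelfAdjoint.all _) (IsSelfAdjoint.one _))

theorem tr_potential (hH : Module.finrank ℂ H ≠ 0) (ρ σ : Op H) : tr (potential ρ σ) = 0 := by
  have h := tr_im_eq_zero ((isSelfAdjoint_opLog ρ).sub (isSelfAdjoint_opLog σ))
  rw [potential, tr_sub, tr_real_smul, tr_one]
  have h2 : (Module.finrank ℂ H : ℂ) ≠ 0 := by exact_mod_cast hH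
  push_cast
  rw [div_mul_cancel₀ _ h2, sub_eq_zero]
  exact Complex.ext (by simp) (by simpa using h)

theorem grad_smul_potential (r : ℝ) (ρ σ : Op H) (j : J) :
    R.grad (r • potential ρ σ) j = r • R.grad (opLog ρ - opLog σ) j := by
  simp only [grad, comm, potential, mul_smul_comm, smul_mul_assoc, mul_sub, sub_mul, mul_one,
    one_mul, smul_sub]
  abel

namespace IsDetailedBalance

variable (hR : R.IsDetailedBalance σ)
include hR

theorem div_bracket_grad_smul_potential (hσ : IsStrictlyPositive σ) (hρ : IsStrictlyPositive ρ)
    (r : ℝ) : R.div (fun j => bracket ρ (R.ω j) (R.grad (r • potential ρ σ) j)) =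
      r • R.dual ρ := by
  rw [← hR.div_bracket_grad hσ hρ]
  simp only [grad_smul_potential, bracket_smul, div, comm, smul_mul_assoc, mul_smul_comm,
    Finset.smul_sum, smul_sub, smul_comm r]

theorem tr_dual (hσ : IsStrictlyPositive σ) (ρ : Op H) : tr (R.dual ρ) = 0 := by
  have h := hR.tr_dual_mul hσ ρ 1
  rw [mul_one] at h
  rw [h]
  simp [generator, comm, ← trCLM_apply]

/-- After integration by parts, the scalar subtracted in `potential` pairs with `R.dual ρ`, which
has trace zero. -/
theorem normSq_grad_smul_potential (hσ : IsStrictlyPositive σ) (hρ : IsStrictlyPositive ρ)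
    (r : ℝ) : R.normSq ρ (R.grad (r • potential ρ σ)) =
      r ^ 2 * entropyProduction R.generator σ ρ := by
  rw [normSq_grad_eq (IsSelfAdjoint.smul (IsSelfAdjoint.all r) (isSelfAdjoint_potential ρ σ)),
    hR.div_bracket_grad_smul_potential hσ hρ, hR.entropyProduction_eq hσ, potential,
    smul_mul_smul_comm, mul_sub, mul_smul_comm, mul_one, tr_real_smul, tr_sub, tr_real_smul,
    hR.tr_dual hσ, mul_zero, sub_zero, Complex.re_ofReal_mul]
  ring

end IsDetailedBalance

end Rep

/-! ### The Schrödinger flow -/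

theorem IsFullRankState.nontrivial {ρ : Op H} (hρ : IsFullRankState ρ) : Nontrivial (Op H) := by
  refine ⟨ρ, 0, fun h0 => ?_⟩
  have h1 := hρ.2
  rw [h0, ← trCLM_apply, map_zero] at h1
  exact zero_ne_one h1

theorem IsFullRankState.finrank_ne_zero {ρ : Op H} (hρ : IsFullRankState ρ) :
    Module.finrank ℂ H ≠ 0 := by
  intro h0
  have := Module.finrank_zero_iff.1 h0
  have := hρ.nontrivial
  exact not_subsingleton (Op H) inferInstance

namespace Rep

variable {J : Type*} [Fintype J] {R : Rep H J} {ρ σ : Op H}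

/-- The Schrödinger evolution of `ρ`. -/
def flow (R : Rep H J) (ρ : Op H) (t : ℝ) : Op H :=
  NormedSpace.exp (t • R.dualCLM) ρ

theorem flow_zero (ρ : Op H) : R.flow ρ 0 = ρ := by
  rw [flow, zero_smul ℝ R.dualCLM, NormedSpace.exp_zero, one_apply_eq_self]

theorem hasDerivAt_flow (ρ : Op H) (t : ℝ) :
    HasDerivAt (R.flow ρ) (R.dual (R.flow ρ t)) t :=
  (hasDerivAt_exp_smul_const' (𝕂 := ℝ) R.dualCLM t).clm_apply (hasDerivAt_const t ρ) |>.congr_deriv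
    (by simp [flow, dualCLM_apply])

/-- The hypotheses on the semigroup, its invariant state and its generator. -/
structure IsGradientFlow (Λ : ℝ → Op H →ₗ[ℂ] Op H) (σ : Op H) (R : Rep H J) : Prop where
  semigroup : IsQuantumMarkovSemigroup Λ
  primitive : IsPrimitive Λ σ
  detailedBalance : R.IsDetailedBalance σ
  generator : IsGenerator Λ R.generator

/-! ### States and entropy decay along the Schrödinger flow -/

namespace IsGradientFlow

open scoped ComplexOrder

variable {Λ : ℝ → Op H →ₗ[ℂ] Op H} (h : IsGradientFlow Λ σ R)
include h

/-- The interpolation `s ↦ Tr (ρ_s Λ_{t-s} f)` has zero derivative by duality of the generators.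
Positivity and trace preservation thereby pass from `Λ` to the exponential. -/
theorem tr_flow_mul (ρ f : Op H) {t : ℝ} (ht : 0 ≤ t) :
    tr (R.flow ρ t * f) = tr (ρ * Λ t f) := by
  have hσ := h.primitive.fullRank.1
  set g : ℝ → ℂ := fun s => tr (R.flow ρ s * Λ (t - s) f) with hg
  have hd : ∀ s ∈ Set.Icc 0 t, HasDerivWithinAt g 0 (Set.Icc 0 t) s := by
    intro s hs
    have h1 := (hasDerivAt_flow (R := R) ρ s).hasDerivWithinAt (s := Set.Icc 0 t)
    have h2 := h.generator (t - s) (sub_nonneg.2 hs.2) f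
    have h3 : HasDerivWithinAt (fun s : ℝ => t - s) (-1) (Set.Icc 0 t) s := by
      simpa using ((hasDerivAt_id s).const_sub t).hasDerivWithinAt
    have h4 := h2.1.scomp s h3 fun u hu => sub_nonneg.2 hu.2
    have h5 := (trCLM H).restrictScalars ℝ |>.hasFDerivAt.comp_hasDerivWithinAt s (h1.mul h4)
    refine (h5.congr_deriv ?_ : _)
    rw [h2.2]
    change tr (R.dual (R.flow ρ s) * Λ (t - s) f +
      R.flow ρ s * ((-1 : ℝ) • R.generator (Λ (t - s) f))) = 0
    rw [neg_one_smul, mul_neg, tr_add, tr_neg, h.detailedBalance.tr_dual_mul hσ, add_neg_cancel]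
  have hconst := constant_of_derivWithin_zero (a := 0) (b := t)
    (fun s hs => (hd s hs).differentiableWithinAt) (fun s hs => by
      rcases ht.eq_or_lt with h0 | h0
      · subst h0
        simp at hs
      · exact (hd s (Set.Ico_subset_Icc_self hs)).derivWithin
          (uniqueDiffOn_Icc h0 s (Set.Ico_subset_Icc_self hs)))
    t ⟨ht, le_rfl⟩
  simpa [hg, h.semigroup.zero, flow_zero] using hconst

theorem flow_invariant {t : ℝ} (ht : 0 ≤ t) : R.flow σ t = σ :=
  eq_of_tr_mul_eq fun f => by rw [h.tr_flow_mul σ f ht, h.primitive.invariant t ht]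

theorem flow_nonneg (hρ : 0 ≤ ρ) {t : ℝ} (ht : 0 ≤ t) : 0 ≤ R.flow ρ t := by
  refine nonneg_of_tr_mul_nonneg fun f hf => ?_
  rw [h.tr_flow_mul ρ f ht]
  obtain ⟨Φ, hΦ⟩ := h.semigroup.completelyPositive t ht
  refine tr_mul_nonneg hρ ?_
  rw [← hΦ]
  exact map_nonneg Φ hf

/-- Some `c > 0` satisfies `c σ ≤ ρ`; the flow preserves order and fixes `σ`, so `c σ` remains a
lower bound at all later times. -/
theorem isFullRankState_flow (hρ : IsFullRankState ρ) {t : ℝ} (ht : 0 ≤ t) :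
    IsFullRankState (R.flow ρ t) := by
  refine ⟨?_, ?_⟩
  · have hσ := h.primitive.fullRank.1
    have := hρ.nontrivial
    obtain ⟨r, hr, hle⟩ := (CFC.exists_pos_algebraMap_le_iff hρ.1.isSelfAdjoint).2
      fun x hx => hρ.1.spectrum_pos hx
    have hle2 := hσ.isSelfAdjoint.le_algebraMap_norm_self
    set c := r / (‖σ‖ + 1) with hc
    have hn : 0 < ‖σ‖ + 1 := by positivity
    have hc0 : 0 < c := div_pos hr hn
    have h1 : c • σ ≤ ρ := by
      refine le_trans ?_ hle
      refine (smul_le_smul_of_nonneg_left hle2 hc0.le).trans ?_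
      rw [Algebra.algebraMap_eq_smul_one, Algebra.algebraMap_eq_smul_one, smul_smul]
      refine smul_le_smul_of_nonneg_right ?_ zero_le_one
      rw [hc, div_mul_eq_mul_div, div_le_iff₀ hn]
      nlinarith
    have h2 := h.flow_nonneg (sub_nonneg.2 h1) ht
    have h3 : R.flow (ρ - c • σ) t = R.flow ρ t - c • σ := by
      conv_rhs => rw [← h.flow_invariant ht]
      simp [flow]
    rw [h3, sub_nonneg] at h2
    exact (hσ.smul hc0).of_le h2
  · have h1 := h.tr_flow_mul ρ 1 ht
    rwa [h.semigroup.unital t ht, mul_one, mul_one, hρ.2] at h1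

theorem hasDerivWithinAt_relEntropy_flow (hρ : IsFullRankState ρ) {t : ℝ} (ht : 0 ≤ t) :
    HasDerivWithinAt (fun t => relEntropy (R.flow ρ t) σ)
      (-entropyProduction R.generator σ (R.flow ρ t)) (Set.Ici 0) t := by
  rw [h.detailedBalance.entropyProduction_eq h.primitive.fullRank.1, neg_neg]
  exact hasDerivWithinAt_relEntropy (s := Set.Ici 0) ht
    (fun u hu => h.isFullRankState_flow hρ hu) (hasDerivAt_flow ρ t).hasDerivWithinAt

/-- Grönwall: MLSI says that `e^{2αt} D(ρ_t‖σ)` has nonpositive derivative. -/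
theorem relEntropy_flow_le {α : ℝ} (hM : MLSI R.generator σ α) (hρ : IsFullRankState ρ) {t : ℝ}
    (ht : 0 ≤ t) : relEntropy (R.flow ρ t) σ ≤ relEntropy ρ σ * Real.exp (-(2 * α * t)) := by
  set G : ℝ → ℝ := fun t => relEntropy (R.flow ρ t) σ * Real.exp (2 * α * t) with hG
  have hd : ∀ s, 0 ≤ s → HasDerivWithinAt G (-entropyProduction R.generator σ (R.flow ρ s) *
      Real.exp (2 * α * s) + relEntropy (R.flow ρ s) σ * (Real.exp (2 * α * s) * (2 * α)))
      (Set.Ici 0) s := by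
    intro s hs
    have h1 : HasDerivAt (fun s : ℝ => 2 * α * s) (2 * α) s := by
      simpa using (hasDerivAt_id s).const_mul (2 * α)
    exact (h.hasDerivWithinAt_relEntropy_flow hρ hs).mul h1.exp.hasDerivWithinAt
  have hanti : AntitoneOn G (Set.Ici 0) := by
    refine antitoneOn_of_hasDerivWithinAt_nonpos (convex_Ici 0)
      (fun s hs => (hd s hs).continuousWithinAt)
      (fun s hs => (hd s (interior_subset hs)).mono interior_subset) fun s hs => ?_
    have h2 := hM _ (h.isFullRankState_flow hρ (interior_subset hs))
    nlinarith [Real.exp_pos (2 * α * s)]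
  have h3 := hanti (Set.self_mem_Ici) ht ht
  simp only [hG, mul_zero, Real.exp_zero, mul_one, flow_zero] at h3
  rw [Real.exp_neg, ← div_eq_mul_inv, le_div_iff₀ (Real.exp_pos _)]
  exact h3

theorem norm_flow_sub_le {α : ℝ} (hM : MLSI R.generator σ α) (hρ : IsFullRankState ρ) {t : ℝ}
    (ht : 0 ≤ t) : ‖R.flow ρ t - σ‖ ≤ √(4 * relEntropy ρ σ) * Real.exp (-(α * t)) := by
  have h1 := sq_norm_sub_le_relEntropy (h.isFullRankState_flow hρ ht) h.primitive.fullRank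
  have h2 := h.relEntropy_flow_le hM hρ ht
  have h3 := relEntropy_nonneg hρ h.primitive.fullRank
  refine abs_le_of_sq_le_sq' ?_ (by positivity) |>.2
  rw [mul_pow, Real.sq_sqrt (by positivity), ← Real.exp_nat_mul]
  have h4 : ((2 : ℕ) : ℝ) * -(α * t) = -(2 * α * t) := by push_cast; ring
  rw [h4]
  linarith

end IsGradientFlow

end Rep

/-! ### Flat gluing and an integral bound -/

section FlatGlue

open Polynomial Filter Topology
open scoped ContDiff

variable {E : Type*} [NormedAddCommGroup E] [NormedSpace ℝ E]

theorem tendsto_eval_mul_exp_neg_atTop (p : ℝ[X]) {ε : ℝ} (hε : 0 < ε) :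
    Tendsto (fun x => p.eval x * Real.exp (-(ε * x))) atTop (𝓝 0) := by
  have h := (p.comp (C ε⁻¹ * X)).tendsto_div_exp_atTop.comp (tendsto_id.const_mul_atTop hε)
  refine h.congr fun x => ?_
  simp [Real.exp_neg, div_eq_mul_inv, hε.ne']

variable {N : ℝ → E} {q : ℝ[X]} {K : E →L[ℝ] E} {C ε : ℝ}

theorem tendsto_eval_inv_smul_of_flat (hε : 0 < ε) (h0 : ∀ u ≤ 0, N u = 0)
    (hb : ∀ u, 0 < u → u ≤ 1 → ‖N u‖ ≤ C * Real.exp (-(ε * u⁻¹))) (p : ℝ[X]) (A : E →L[ℝ] E) :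
    Tendsto (fun u => p.eval u⁻¹ • A (N u)) (𝓝 0) (𝓝 0) := by
  have hpos : Tendsto (fun u : ℝ => ‖A‖ * C * |p.eval u⁻¹ * Real.exp (-(ε * u⁻¹))|)
      (𝓝[>] 0) (𝓝 0) := by
    simpa using (((tendsto_eval_mul_exp_neg_atTop p hε).comp tendsto_inv_nhdsGT_zero).abs).const_mul
      (‖A‖ * C)
  have h1 : Tendsto (fun u => p.eval u⁻¹ • A (N u)) (𝓝[>] 0) (𝓝 0) := by
    refine squeeze_zero_norm' ?_ hpos
    filter_upwards [Ioc_mem_nhdsGT (zero_lt_one' ℝ)] with u hu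
    rw [norm_smul, abs_mul, abs_of_pos (Real.exp_pos _), Real.norm_eq_abs]
    calc |p.eval u⁻¹| * ‖A (N u)‖ ≤ |p.eval u⁻¹| * (‖A‖ * (C * Real.exp (-(ε * u⁻¹)))) := by
          gcongr
          exact (A.le_opNorm _).trans (by gcongr; exact hb u hu.1 hu.2)
      _ = _ := by ring
  have h2 : Tendsto (fun u => p.eval u⁻¹ • A (N u)) (𝓝[≤] 0) (𝓝 0) := by
    refine tendsto_const_nhds.congr' ?_
    filter_upwards [self_mem_nhdsWithin] with u hu
    rw [h0 u hu, map_zero, smul_zero]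
  have := h2.sup h1
  rwa [← nhdsWithin_union, Set.Iic_union_Ioi, nhdsWithin_univ] at this

variable (hε : 0 < ε) (h0 : ∀ u ≤ 0, N u = 0)
  (hd : ∀ u, 0 < u → HasDerivAt N (q.eval u⁻¹ • K (N u)) u)
  (hb : ∀ u, 0 < u → u ≤ 1 → ‖N u‖ ≤ C * Real.exp (-(ε * u⁻¹)))
include hε h0 hd hb

/-- Curves `p(1/u) A N(u)` have derivatives that are sums of two curves of the same kind, which is
what the smoothness induction needs. -/
theorem hasDerivAt_eval_inv_smul_of_flat (p : ℝ[X]) (A : E →L[ℝ] E) (u : ℝ) :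
    HasDerivAt (fun u => p.eval u⁻¹ • A (N u))
      ((-X ^ 2 * derivative p).eval u⁻¹ • A (N u) + (p * q).eval u⁻¹ • (A ∘L K) (N u)) u := by
  rcases lt_trichotomy u 0 with hu | rfl | hu
  · simp only [h0 u hu.le, map_zero, smul_zero, add_zero]
    refine (hasDerivAt_const u (0 : E)).congr_of_eventuallyEq ?_
    filter_upwards [gt_mem_nhds hu] with y hy
    rw [h0 y hy.le, map_zero, smul_zero]
  · simp only [h0 0 le_rfl, map_zero, smul_zero, add_zero]
    rw [hasDerivAt_iff_tendsto_slope]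
    -- The slope at `0` divides by `u`, which replaces `p` by `X * p`; flatness absorbs the extra
    -- power.
    refine ((tendsto_eval_inv_smul_of_flat hε h0 hb (X * p) A).mono_left inf_le_left).congr
      fun u => ?_
    simp [slope_def_module, h0 0 le_rfl, smul_smul]
  · have h1 : HasDerivAt (fun u : ℝ => p.eval u⁻¹) ((derivative p).eval u⁻¹ * (-(u ^ 2)⁻¹)) u :=
      (p.hasDerivAt u⁻¹).comp u (hasDerivAt_inv hu.ne')
    have h2 := h1.smul (A.hasFDerivAt.comp_hasDerivAt u (hd u hu))
    refine h2.congr_deriv ?_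
    simp only [Function.comp_apply, ContinuousLinearMap.comp_apply, map_smul, smul_smul, eval_mul,
      eval_neg, eval_pow, eval_X, inv_pow]
    rw [add_comm]
    congr 2
    ring

theorem hasDerivAt_of_flat (u : ℝ) : HasDerivAt N (q.eval u⁻¹ • K (N u)) u := by
  simpa using hasDerivAt_eval_inv_smul_of_flat hε h0 hd hb 1 (.id ℝ E) u

/-- A curve that vanishes on `(-∞, 0]`, decays like `exp (-ε / u)` as `u → 0+`, and solves
`N' = q(1/u) K N` for `u > 0` with a polynomial `q` and a continuous linear `K`, is smooth. -/
theorem contDiff_of_flat : ContDiff ℝ ∞ N := by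
  have key : ∀ (n : ℕ) (p : ℝ[X]) (A : E →L[ℝ] E),
      ContDiff ℝ n (fun u => p.eval u⁻¹ • A (N u)) := by
    intro n
    induction n with
    | zero =>
      intro p A
      exact contDiff_zero.2 (continuous_iff_continuousAt.2 fun u =>
        (hasDerivAt_eval_inv_smul_of_flat hε h0 hd hb p A u).continuousAt)
    | succ n ih =>
      intro p A
      rw [show ((n + 1 : ℕ) : WithTop ℕ∞) = (n : WithTop ℕ∞) + 1 by push_cast; rfl,
        contDiff_succ_iff_deriv]
      refine ⟨fun u => (hasDerivAt_eval_inv_smul_of_flat hε h0 hd hb p A u).differentiableAt,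
        by simp, ?_⟩
      rw [funext fun u => (hasDerivAt_eval_inv_smul_of_flat hε h0 hd hb p A u).deriv]
      exact (ih _ _).add (ih _ _)
  rw [contDiff_infty]
  intro n
  simpa using key n 1 (.id ℝ E)

end FlatGlue

section Lintegral

open MeasureTheory Set

/-- A nonnegative derivative of a continuous function is automatically integrable, and the lower
integral is monotone without measurability of `f`. -/
theorem lintegral_ofReal_le_of_hasDerivAt {f Ψ Ψ' : ℝ → ℝ} {a b : ℝ} (hab : a ≤ b)
    (hc : ContinuousOn Ψ (Icc a b)) (hd : ∀ s ∈ Ioo a b, HasDerivAt Ψ (Ψ' s) s)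
    (h0 : ∀ s ∈ Ioo a b, 0 ≤ Ψ' s) (hf : ∀ s ∈ Ioo a b, f s ≤ Ψ' s) :
    ∫⁻ s in Icc a b, ENNReal.ofReal (f s) ≤ ENNReal.ofReal (Ψ b - Ψ a) := by
  have hint := intervalIntegral.integrableOn_deriv_of_nonneg hc hd h0
  have hint' : IntegrableOn Ψ' (Ioo a b) := hint.mono_set Ioo_subset_Ioc_self
  rw [setLIntegral_congr Ioo_ae_eq_Icc.symm]
  calc ∫⁻ s in Ioo a b, ENNReal.ofReal (f s) ≤ ∫⁻ s in Ioo a b, ENNReal.ofReal (Ψ' s) :=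
        setLIntegral_mono' measurableSet_Ioo fun s hs => ENNReal.ofReal_le_ofReal (hf s hs)
    _ = ENNReal.ofReal (∫ s in Ioo a b, Ψ' s) :=
        (ofReal_integral_eq_lintegral_ofReal hint'
          ((ae_restrict_iff' measurableSet_Ioo).2 (Filter.Eventually.of_forall h0))).symm
    _ = _ := by
        rw [← integral_Ioc_eq_integral_Ioo, ← intervalIntegral.integral_of_le hab,
          intervalIntegral.integral_eq_sub_of_hasDerivAt_of_le hab hc hd
            ((intervalIntegrable_iff_integrableOn_Ioc_of_le hab).2 hint)]

end Lintegral

/-! ### The reparametrised flow -/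

section Clock

/-- The time at which the flow has remaining parameter `u`; it tends to infinity as `u → 0+`. -/
def clock (α ε u : ℝ) : ℝ := (ε * (u⁻¹ - 1) - Real.log u) / α

/-- The speed `- d/du clock`. -/
def rate (α ε u : ℝ) : ℝ := (u⁻¹ + ε * u⁻¹ ^ 2) / α

variable {α ε u : ℝ}

theorem clock_one : clock α ε 1 = 0 := by simp [clock]

theorem hasDerivAt_clock (hu : u ≠ 0) : HasDerivAt (clock α ε) (-rate α ε u) u := by
  have h := ((((hasDerivAt_inv hu).sub_const 1).const_mul ε).sub (Real.hasDerivAt_log hu)).div_const α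
  refine h.congr_deriv ?_
  rw [rate]
  field_simp
  ring

theorem hasDerivAt_rate (hu : u ≠ 0) :
    HasDerivAt (rate α ε) (-(u⁻¹ ^ 2 + 2 * ε * u⁻¹ ^ 3) / α) u := by
  have h := ((hasDerivAt_inv hu).add (((hasDerivAt_inv hu).pow 2).const_mul ε)).div_const α
  refine h.congr_deriv ?_
  push_cast
  field_simp
  ring

theorem clock_nonneg (hα : 0 < α) (hε : 0 < ε) (hu : 0 < u) (hu1 : u ≤ 1) : 0 ≤ clock α ε u := by
  have h1 : 1 ≤ u⁻¹ := (one_le_inv₀ hu).2 hu1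
  have h2 := Real.log_nonpos hu.le hu1
  have h3 := mul_nonneg hε.le (sub_nonneg.2 h1)
  exact div_nonneg (by linarith) hα.le

theorem exp_neg_mul_clock (hα : 0 < α) (hu : 0 < u) :
    Real.exp (-(α * clock α ε u)) = u * Real.exp ε * Real.exp (-(ε * u⁻¹)) := by
  have h : -(α * clock α ε u) = Real.log u + ε + -(ε * u⁻¹) := by
    rw [clock, mul_div_cancel₀ _ hα.ne']
    ring
  rw [h, Real.exp_add, Real.exp_add, Real.exp_log hu]

/-- The product equals `(e^ε/α) (1 + x) e^{-x}` with `x = ε/u`, and `1 + x ≤ e^x`. -/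
theorem rate_mul_exp_le (hα : 0 < α) (hε : 0 < ε) (hu : 0 < u) :
    rate α ε u * Real.exp (-(α * clock α ε u)) ≤ Real.exp ε / α := by
  have h : (1 + ε * u⁻¹) * Real.exp (-(ε * u⁻¹)) ≤ 1 := by
    rw [Real.exp_neg, ← div_eq_mul_inv, div_le_one (Real.exp_pos _), add_comm]
    exact Real.add_one_le_exp _
  rw [exp_neg_mul_clock hα hu]
  calc rate α ε u * (u * Real.exp ε * Real.exp (-(ε * u⁻¹)))
      = Real.exp ε / α * ((1 + ε * u⁻¹) * Real.exp (-(ε * u⁻¹))) := by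
        rw [rate]
        field_simp
    _ ≤ Real.exp ε / α * 1 := by gcongr
    _ = _ := mul_one _

theorem rate_nonneg (hα : 0 < α) (hε : 0 < ε) (hu : 0 ≤ u) : 0 ≤ rate α ε u := by
  rw [rate]
  positivity

theorem exp_neg_two_mul_clock : Real.exp (-(2 * α * clock α ε u)) =
    Real.exp (-(α * clock α ε u)) ^ 2 := by
  rw [← Real.exp_nat_mul]
  push_cast
  ring_nf

theorem exp_neg_clock_le (hα : 0 < α) (hε : 0 < ε) (hu : 0 < u) :
    Real.exp (-(α * clock α ε u)) ≤ u * Real.exp ε := by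
  rw [exp_neg_mul_clock hα hu]
  have : Real.exp (-(ε * u⁻¹)) ≤ 1 := Real.exp_le_one_iff.2 (by
    have := mul_pos hε (inv_pos.2 hu); linarith)
  exact mul_le_of_le_one_right (by positivity) this

open Polynomial in
theorem eval_rate_polynomial (α ε u : ℝ) :
    (-(C α⁻¹ * (X + C ε * X ^ 2)) : ℝ[X]).eval u⁻¹ = -rate α ε u := by
  simp [rate]
  ring

end Clock

/-! ### The compressed path from `ρ` to `σ` and its action -/

namespace Rep

variable {J : Type*} [Fintype J] {R : Rep H J} {ρ σ : Op H} {α ε : ℝ}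

/-- The deviation of the flow from `σ` as a function of the remaining parameter. -/
def deviation (R : Rep H J) (ρ σ : Op H) (α ε u : ℝ) : Op H :=
  if 0 < u then R.flow ρ (clock α ε u) - σ else 0

/-- The Schrödinger flow from `ρ` to `σ`, reparametrised by `[0, 1]`. -/
def flowPath (R : Rep H J) (ρ σ : Op H) (α ε s : ℝ) : Op H :=
  σ + R.deviation ρ σ α ε (1 - s)

theorem flowPath_of_lt {s : ℝ} (hs : s < 1) :
    R.flowPath ρ σ α ε s = R.flow ρ (clock α ε (1 - s)) := by
  rw [flowPath, deviation, if_pos (by linarith), add_sub_cancel]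

theorem flowPath_zero : R.flowPath ρ σ α ε 0 = ρ := by
  rw [flowPath_of_lt one_pos, sub_zero, clock_one, flow_zero]

theorem flowPath_one : R.flowPath ρ σ α ε 1 = σ := by
  simp [flowPath, deviation]

theorem IsDetailedBalance.dual_self (hR : R.IsDetailedBalance σ) (hσ : IsStrictlyPositive σ) :
    R.dual σ = 0 := by
  rw [← hR.div_bracket_grad hσ hσ]
  simp [div, grad, comm, bracket, modularCalc]

namespace IsGradientFlow

variable {Λ : ℝ → Op H →ₗ[ℂ] Op H} (h : IsGradientFlow Λ σ R)
include h

theorem hasDerivAt_deviation_of_pos {u : ℝ} (hu : 0 < u) :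
    HasDerivAt (R.deviation ρ σ α ε)
      (-rate α ε u • R.dualCLM (R.deviation ρ σ α ε u)) u := by
  have h1 := ((hasDerivAt_flow (R := R) ρ (clock α ε u)).scomp u
    (hasDerivAt_clock hu.ne')).sub_const σ
  have h2 : HasDerivAt (R.deviation ρ σ α ε)
      (-rate α ε u • R.dual (R.flow ρ (clock α ε u))) u := by
    refine h1.congr_of_eventuallyEq ?_
    filter_upwards [lt_mem_nhds hu] with v hv
    rw [deviation, if_pos hv, Function.comp_apply]
  refine h2.congr_deriv ?_
  rw [deviation, if_pos hu, map_sub, dualCLM_apply, dualCLM_apply,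
    h.detailedBalance.dual_self h.primitive.fullRank.1, sub_zero]

theorem norm_deviation_le (hα : 0 < α) (hε : 0 < ε) (hM : MLSI R.generator σ α)
    (hρ : IsFullRankState ρ) {u : ℝ} (hu : 0 < u) (hu1 : u ≤ 1) :
    ‖R.deviation ρ σ α ε u‖ ≤
      √(4 * relEntropy ρ σ) * Real.exp ε * Real.exp (-(ε * u⁻¹)) := by
  rw [deviation, if_pos hu]
  refine (h.norm_flow_sub_le hM hρ (clock_nonneg hα hε hu hu1)).trans ?_
  rw [exp_neg_mul_clock hα hu, mul_assoc √_, mul_assoc u]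
  exact mul_le_mul_of_nonneg_left (mul_le_of_le_one_left (by positivity) hu1) (Real.sqrt_nonneg _)

section

open Polynomial

theorem contDiff_flowPath (hα : 0 < α) (hε : 0 < ε) (hM : MLSI R.generator σ α)
    (hρ : IsFullRankState ρ) :
    ContDiff ℝ ((⊤ : ℕ∞) : WithTop ℕ∞) (R.flowPath ρ σ α ε) := by
  have h1 : ContDiff ℝ ((⊤ : ℕ∞) : WithTop ℕ∞) (R.deviation ρ σ α ε) :=
    contDiff_of_flat (q := -(C α⁻¹ * (X + C ε * X ^ 2))) (K := R.dualCLM) hε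
      (fun u hu => if_neg (not_lt.2 hu))
      (fun u hu => by
        rw [eval_rate_polynomial]
        exact h.hasDerivAt_deviation_of_pos hu)
      (fun u hu hu1 => h.norm_deviation_le hα hε hM hρ hu hu1)
  exact contDiff_const.add (h1.comp (contDiff_const.sub contDiff_id))

/-- At `s = 1` the convention `0⁻¹ = 0` makes the rate zero, which agrees with the flat endpoint, so
the equation holds there too. -/
theorem hasDerivAt_flowPath (hα : 0 < α) (hε : 0 < ε) (hM : MLSI R.generator σ α)
    (hρ : IsFullRankState ρ) (s : ℝ) :
    HasDerivAt (R.flowPath ρ σ α ε)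
      (rate α ε (1 - s) • R.dual (R.flowPath ρ σ α ε s)) s := by
  have h1 : HasDerivAt (R.deviation ρ σ α ε)
      (-rate α ε (1 - s) • R.dualCLM (R.deviation ρ σ α ε (1 - s))) (1 - s) := by
    rw [← eval_rate_polynomial]
    exact hasDerivAt_of_flat (K := R.dualCLM) hε
      (fun u hu => if_neg (not_lt.2 hu))
      (fun u hu => by
        rw [eval_rate_polynomial]
        exact h.hasDerivAt_deviation_of_pos hu)
      (fun u hu hu1 => h.norm_deviation_le hα hε hM hρ hu hu1) (1 - s)
  have h2 : HasDerivAt (fun s : ℝ => 1 - s) (-1) s := by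
    simpa using (hasDerivAt_id s).const_sub 1
  refine ((h1.scomp s h2).const_add σ).congr_deriv ?_
  rw [neg_one_smul, neg_smul, neg_neg, flowPath, ← dualCLM_apply (R := R) (σ + _), map_add,
    dualCLM_apply σ, h.detailedBalance.dual_self h.primitive.fullRank.1, zero_add]

end

theorem isFullRankState_flowPath (hα : 0 < α) (hε : 0 < ε) (hρ : IsFullRankState ρ) {s : ℝ}
    (hs : s ∈ Set.Icc (0 : ℝ) 1) : IsFullRankState (R.flowPath ρ σ α ε s) := by
  rcases hs.2.eq_or_lt with rfl | h1
  · rw [flowPath_one]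
    exact h.primitive.fullRank
  · rw [flowPath_of_lt h1]
    exact h.isFullRankState_flow hρ (clock_nonneg hα hε (by linarith) (by linarith [hs.1]))

/-- The minus sign in the potential cancels the one in the continuity equation. -/
theorem isAdmissible_flowPath (hα : 0 < α) (hε : 0 < ε) (hM : MLSI R.generator σ α)
    (hρ : IsFullRankState ρ) :
    R.IsAdmissible ρ σ (R.flowPath ρ σ α ε)
      (fun s => -rate α ε (1 - s) • potential (R.flowPath ρ σ α ε s) σ) where
  smooth := (h.contDiff_flowPath hα hε hM hρ).contDiffOn
  fullRank _ hs := h.isFullRankState_flowPath hα hε hρ hs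
  source := flowPath_zero
  target := flowPath_one
  selfAdjoint _ _ := IsSelfAdjoint.smul (IsSelfAdjoint.all _) (isSelfAdjoint_potential _ _)
  traceless _ _ := by
    rw [tr_real_smul, tr_potential hρ.finrank_ne_zero, mul_zero]
  continuity s hs := by
    rw [(h.hasDerivAt_flowPath hα hε hM hρ s).hasDerivWithinAt.derivWithin
        (uniqueDiffOn_Icc one_pos s hs),
      h.detailedBalance.div_bracket_grad_smul_potential h.primitive.fullRank.1
        (h.isFullRankState_flowPath hα hε hρ hs).1, neg_smul, neg_neg]

/-- The action of the reparametrised flow. -/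
theorem lintegral_normSq_flowPath_le (hα : 0 < α) (hε : 0 < ε) (hM : MLSI R.generator σ α)
    (hρ : IsFullRankState ρ) :
    ∫⁻ s in Set.Icc (0 : ℝ) 1, ENNReal.ofReal (R.normSq (R.flowPath ρ σ α ε s)
        (R.grad (-rate α ε (1 - s) • potential (R.flowPath ρ σ α ε s) σ))) ≤
      ENNReal.ofReal (2 * α⁻¹ * relEntropy ρ σ * Real.exp ε ^ 2) := by
  have hσ := h.primitive.fullRank
  set D := relEntropy ρ σ with hD
  have hD0 : 0 ≤ D := relEntropy_nonneg hρ hσ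
  set e : ℝ → ℝ := fun s => relEntropy (R.flowPath ρ σ α ε s) σ with he
  set EP : ℝ → ℝ := fun s => entropyProduction R.generator σ (R.flowPath ρ σ α ε s) with hEP
  set Q : ℝ → ℝ := fun s => Real.exp (-(2 * α * clock α ε (1 - s))) with hQ
  set W : ℝ → ℝ := fun s => rate α ε (1 - s) * (D * Q s - e s) with hW
  set A := 2 * α⁻¹ * D * Real.exp ε ^ 2 with hA
  have hstate : ∀ s ∈ Set.Icc (0 : ℝ) 1, IsFullRankState (R.flowPath ρ σ α ε s) :=
    fun s hs => h.isFullRankState_flowPath hα hε hρ hs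
  have hsub : ∀ s : ℝ, HasDerivAt (fun s : ℝ => 1 - s) (-1) s := fun s => by
    simpa using (hasDerivAt_id s).const_sub 1
  have he0 : ∀ s ∈ Set.Icc (0 : ℝ) 1, 0 ≤ e s := fun s hs => relEntropy_nonneg (hstate s hs) hσ
  have heQ : ∀ s ∈ Set.Ico (0 : ℝ) 1, e s ≤ D * Q s := fun s hs => by
    simp only [he, flowPath_of_lt hs.2]
    exact h.relEntropy_flow_le hM hρ
      (clock_nonneg hα hε (by linarith [hs.2]) (by linarith [hs.1]))
  have hed : ∀ s ∈ Set.Icc (0 : ℝ) 1,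
      HasDerivWithinAt e (-(rate α ε (1 - s) * EP s)) (Set.Icc 0 1) s := fun s hs => by
    refine (hasDerivWithinAt_relEntropy hs hstate
      (h.hasDerivAt_flowPath hα hε hM hρ s).hasDerivWithinAt).congr_deriv ?_
    simp only [hEP]
    rw [smul_mul_assoc, tr_real_smul, Complex.re_ofReal_mul,
      h.detailedBalance.entropyProduction_eq hσ.1]
    ring
  have hQd : ∀ s < 1, HasDerivAt Q (-(2 * α * rate α ε (1 - s)) * Q s) s := fun s hs => by
    have h1 := (((hasDerivAt_clock (α := α) (ε := ε) (u := 1 - s) (by linarith)).comp s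
      (hsub s)).const_mul (2 * α)).neg.exp
    refine h1.congr_deriv ?_
    simp only [hQ, Function.comp_apply, Pi.neg_apply]
    ring
  have hrd : ∀ s < 1, HasDerivAt (fun s => rate α ε (1 - s))
      (((1 - s)⁻¹ ^ 2 + 2 * ε * (1 - s)⁻¹ ^ 3) / α) s := fun s hs => by
    have h1 := (hasDerivAt_rate (α := α) (ε := ε) (u := 1 - s) (by linarith)).comp s (hsub s)
    refine h1.congr_deriv ?_
    ring
  -- One factor `e^{-αt}` of `Q` controls the rate, which blows up; the other is `O(1 - s)` and
  -- forces `W → 0` at the endpoint.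
  have hWle : ∀ s ∈ Set.Ico (0 : ℝ) 1,
      |W s| ≤ D * (Real.exp ε / α) * ((1 - s) * Real.exp ε) := fun s hs => by
    have hu : 0 < 1 - s := by linarith [hs.2]
    have hr := rate_nonneg hα hε hu.le
    have h1 := heQ s hs
    have h2 := he0 s (Set.Ico_subset_Icc_self hs)
    simp only [hW]
    rw [abs_of_nonneg (mul_nonneg hr (sub_nonneg.2 h1))]
    calc rate α ε (1 - s) * (D * Q s - e s) ≤ rate α ε (1 - s) * (D * Q s) := by
          gcongr
          linarith
      _ = D * (rate α ε (1 - s) * Real.exp (-(α * clock α ε (1 - s)))) *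
            Real.exp (-(α * clock α ε (1 - s))) := by
          simp only [hQ]
          rw [exp_neg_two_mul_clock]
          ring
      _ ≤ _ := by
          gcongr
          · exact rate_mul_exp_le hα hε hu
          · exact exp_neg_clock_le hα hε hu
  have hW1 : W 1 = 0 := by simp [hW, rate]
  have hWc : ContinuousOn W (Set.Icc 0 1) := fun s hs => by
    rcases hs.2.eq_or_lt with rfl | h1
    · have hlim : Filter.Tendsto (fun s : ℝ => D * (Real.exp ε / α) * ((1 - s) * Real.exp ε))
          (nhdsWithin 1 (Set.Icc 0 1)) (nhds 0) := by
        have : Continuous fun s : ℝ => D * (Real.exp ε / α) * ((1 - s) * Real.exp ε) := by fun_prop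
        simpa using (this.tendsto 1).mono_left nhdsWithin_le_nhds
      rw [ContinuousWithinAt, hW1]
      refine squeeze_zero_norm' ?_ hlim
      filter_upwards [self_mem_nhdsWithin] with s hs
      rcases hs.2.eq_or_lt with rfl | h1
      · rw [hW1]
        simp
      · exact hWle s ⟨hs.1, h1⟩
    · exact (hrd s h1).continuousAt.continuousWithinAt.mul
        (((hQd s h1).continuousAt.continuousWithinAt.const_mul D).sub
          (hed s hs).continuousWithinAt)
  have hWd : ∀ s ∈ Set.Ioo (0 : ℝ) 1, HasDerivAt (fun s => W s + A * s)
      (((1 - s)⁻¹ ^ 2 + 2 * ε * (1 - s)⁻¹ ^ 3) / α * (D * Q s - e s) + rate α ε (1 - s) *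
        (D * (-(2 * α * rate α ε (1 - s)) * Q s) - -(rate α ε (1 - s) * EP s)) + A) s :=
    fun s hs => by
    have h1 := (hed s (Set.Ioo_subset_Icc_self hs)).hasDerivAt (Icc_mem_nhds hs.1 hs.2)
    have h2 := ((hrd s hs.2).mul (((hQd s hs.2).const_mul D).sub h1)).add
      ((hasDerivAt_id s).const_mul A)
    rw [mul_one] at h2
    exact h2
  -- In `W'` the term `r² EP` appears exactly; the `r'` term is nonnegative and `A` compensates `-2α
  -- D r² Q`.
  have hmain : ∀ s ∈ Set.Ioo (0 : ℝ) 1, rate α ε (1 - s) ^ 2 * EP s ≤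
      ((1 - s)⁻¹ ^ 2 + 2 * ε * (1 - s)⁻¹ ^ 3) / α * (D * Q s - e s) + rate α ε (1 - s) *
        (D * (-(2 * α * rate α ε (1 - s)) * Q s) - -(rate α ε (1 - s) * EP s)) + A :=
    fun s hs => by
    have hu : 0 < 1 - s := by linarith [hs.2]
    have h1 : 0 ≤ ((1 - s)⁻¹ ^ 2 + 2 * ε * (1 - s)⁻¹ ^ 3) / α * (D * Q s - e s) :=
      mul_nonneg (by positivity) (sub_nonneg.2 (heQ s (Set.Ioo_subset_Ico_self hs)))
    have h2 : rate α ε (1 - s) ^ 2 * Q s ≤ (Real.exp ε / α) ^ 2 := by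
      simp only [hQ]
      rw [exp_neg_two_mul_clock, ← mul_pow]
      have := rate_nonneg hα hε hu.le
      exact pow_le_pow_left₀ (by positivity) (rate_mul_exp_le hα hε hu) 2
    have h3 : 2 * α * D * (rate α ε (1 - s) ^ 2 * Q s) ≤ A := by
      calc 2 * α * D * (rate α ε (1 - s) ^ 2 * Q s) ≤ 2 * α * D * (Real.exp ε / α) ^ 2 := by
            gcongr
        _ = A := by
            rw [hA]
            field_simp
    linarith
  -- Entropy production is nonnegative by MLSI itself, since relative entropy is.
  have hEP0 : ∀ s ∈ Set.Ioo (0 : ℝ) 1, 0 ≤ rate α ε (1 - s) ^ 2 * EP s := fun s hs => by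
    have hs' := Set.Ioo_subset_Icc_self hs
    refine mul_nonneg (sq_nonneg _) (le_trans ?_ (hM _ (hstate s hs')))
    exact mul_nonneg (by positivity) (he0 s hs')
  have hfin := lintegral_ofReal_le_of_hasDerivAt zero_le_one
    (hWc.add (by fun_prop : Continuous fun s : ℝ => A * s).continuousOn) hWd
    (fun s hs => (hEP0 s hs).trans (hmain s hs))
    (f := fun s => R.normSq (R.flowPath ρ σ α ε s)
        (R.grad (-rate α ε (1 - s) • potential (R.flowPath ρ σ α ε s) σ)))
    (fun s hs => by
      refine le_trans (le_of_eq ?_) (hmain s hs)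
      rw [h.detailedBalance.normSq_grad_smul_potential hσ.1
        (hstate s (Set.Ioo_subset_Icc_self hs)).1, neg_sq])
  refine hfin.trans (le_of_eq ?_)
  have hW0 : W 0 = 0 := by
    simp only [hW, hQ, he]
    rw [flowPath_zero, sub_zero, clock_one]
    simp [hD]
  simp only [Pi.add_apply, hW0, hW1]
  ring_nf

theorem W2_le (hα : 0 < α) (hM : MLSI R.generator σ α) (hρ : IsFullRankState ρ) :
    R.W2 ρ σ ≤ ENNReal.ofReal (√(2 * α⁻¹ * relEntropy ρ σ)) := by
  have hD0 : 0 ≤ relEntropy ρ σ := relEntropy_nonneg hρ h.primitive.fullRank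
  have hle : ∀ ε, 0 < ε → R.W2 ρ σ ≤
      ENNReal.ofReal (√(2 * α⁻¹ * relEntropy ρ σ * Real.exp ε ^ 2)) := by
    intro ε hε
    rw [W2]
    refine iInf₂_le_of_le _ _
      (iInf_le_of_le (h.isAdmissible_flowPath hα hε hM hρ) ?_)
    rw [Real.sqrt_eq_rpow, ← ENNReal.ofReal_rpow_of_nonneg (by positivity) (by norm_num)]
    exact ENNReal.rpow_le_rpow (h.lintegral_normSq_flowPath_le hα hε hM hρ) (by norm_num)
  -- The loss `e^{2ε}` from smoothing the endpoint disappears as `ε → 0+`, because the distance is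
  -- an infimum that does not depend on `ε`.
  have hcont : Continuous fun ε : ℝ =>
      ENNReal.ofReal (√(2 * α⁻¹ * relEntropy ρ σ * Real.exp ε ^ 2)) :=
    ENNReal.continuous_ofReal.comp (by fun_prop)
  have hlim := (hcont.tendsto 0).mono_left (nhdsWithin_le_nhds (s := Set.Ioi 0))
  rw [Real.exp_zero, one_pow, mul_one] at hlim
  refine ge_of_tendsto hlim ?_
  filter_upwards [self_mem_nhdsWithin] with ε hε
  exact hle ε hε

end IsGradientFlow

end Rep

end QMS

end

theorem mainTheorem1 {H : Type*} [NormedAddCommGroup H] [InnerProductSpace ℂ H]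
    [CompleteSpace H] [FiniteDimensional ℂ H] {J : Type*} [Fintype J]
    (Λ : ℝ → QMS.Op H →ₗ[ℂ] QMS.Op H) (σ : QMS.Op H) (R : QMS.Rep H J)
    (hΛ : QMS.IsQuantumMarkovSemigroup Λ) (hprim : QMS.IsPrimitive Λ σ)
    (hR : R.IsDetailedBalance σ) (hgen : QMS.IsGenerator Λ R.generator)
    (α₁ : ℝ) (hα : 0 < α₁) (hMLSI : QMS.MLSI R.generator σ α₁) :
    R.TC2 σ α₁⁻¹ :=
  fun _ hρ => QMS.Rep.IsGradientFlow.W2_le ⟨hΛ, hprim, hR, hgen⟩ hα hMLSI hρ
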